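/- Let $n\ge 2$, $0<\alpha<1$, and let $\Omega\subset\mathbb R^n$ be a bounded domain of class $C^{2,\alpha}$ with outer unit normal $\nu$ and with $0\in\partial\Omega$. For $p,q\in\mathbb C^n$ write $p\cdot q=\sum_i p_iq_i$ (no conjugation) and let $|p|$ be the Hermitian norm. Let $R_0,r_0>0$, $\mathcal R=\mathbb R+i[-R_0,R_0]\subset\mathbb C$, $B_{r_0}(0)=\{p\in\mathbb C^n:|p|<r_0\}$ and $$\mathcal C(r_0)=\{p\in\mathbb C^n:\ |p|<r_0,\ p\cdot p=0,\ p\cdot\nu(0)\neq0\}.$$ Let $a_1,a_2$ be two conductivities, each satisfying the following hypotheses (for $a=a_1$ and $a=a_2$): (H1) $a=a(s,p)$ depends only on $(s,p)$, and $a(s,p)>0$ for all $(s,p)\in\mathbb R\times\mathbb R^n$; (H2) $a$ (restricted to real $s$ and real $p$ with $|p|<r_0$) has an analytic continuation, still denoted $a$, to $\mathcal R\times B_{r_0}(0)$; (H3) there are a constant $\tilde\lambda>0$ and continuous functions $\lambda<\Lambda$ on $\mathcal R\times B_{r_0}(0)$ such that $\tilde\lambda\le\lambda(s,p)\le\operatorname{Re}a(s,p)$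 and $|a(s,p)|+|\nabla_pa(s,p)|\le\Lambda(s,p)$ for all $(s,p)\in\mathcal R\times B_{r_0}(0)$. For $s\in\mathbb R$, $p\in\mathbb C^n$ with $p\cdot p=0$, put $u_{s,p}(x)=s+x\cdot p$. For $h\in C^{2,\alpha}(\overline\Omega)$ (complex-valued) consider complex-valued solutions $v\in C^{2,\alpha}(\overline\Omega)$ of the linearized problem $$\operatorname{div}\Big[a(u_{s,p},p)\nabla v+p\big\{\nabla_pa(u_{s,p},p)\cdot\nabla v+\partial_sa(u_{s,p},p)\,v\big\}\Big]=0\ \text{ in }\Omega,\qquad v|_{\partial\Omega}=h|_{\partial\Omega},$$ and let $\widetilde\Gamma_{\ell,a,s,p}[h]$ be the linearized Dirichlet-to-Neumann map $$\widetilde\Gamma_{\ell,a,s,p}[h]=\Big[a(u_{s,p},p)\nabla v+p\big\{\nabla_pa(u_{s,p},p)\cdot\nabla v+\partial_sa(u_{s,p},p)\,v\big\}\Big]\cdot\nu\Big|_{\partial\Omega},$$ understood as the set of the functions on $\partial\Omega$ that the right-hand side gives as $v$ runs over all solutions with data $h$ (a single function when the problem is uniquely solvable). Suppose that for every $s\in\mathbb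 R$ there is $\rho>0$ such that for all $p\in\mathbb C^n$ with $p\cdot p=0$ and $|p|<\rho$ one has $$\widetilde\Gamma_{\ell,a_1,s,p}[h]=\widetilde\Gamma_{\ell,a_2,s,p}[h]\qquad\text{for all }h\in C^{2,\alpha}(\overline\Omega).$$ Then $a_1\equiv a_2$ on $\mathcal R\times\mathcal C(r_0)$. -/

import Mathlib

open Set Metric Filter Topology
open scoped NNReal Gradient

noncomputable section

namespace QuasilinearCalderon

/-- Real Euclidean space `ℝⁿ`. -/
abbrev RVec (n : ℕ) : Type := EuclideanSpace ℝ (Fin n)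

/-- Complex Euclidean space `ℂⁿ`, with its Hermitian norm `|p|`. -/
abbrev CVec (n : ℕ) : Type := EuclideanSpace ℂ (Fin n)

/-- The inclusion `ℝⁿ ⊆ ℂⁿ`. -/
def toC {n : ℕ} (x : RVec n) : CVec n := WithLp.toLp 2 fun i => (x i : ℂ)

/-- The bilinear (not Hermitian) product `p · q = ∑ pᵢ qᵢ` on `ℂⁿ`. -/
def cdot {n : ℕ} (p q : CVec n) : ℂ := ∑ i, p i * q i

/-! ### Hölder classes and domains -/

/-- `f ∈ C^{2,α}` of the closure of the open set `Ω`: `f` is `C²` in `Ω`, the function and its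
derivatives of order at most two extend continuously to the closure, and the second derivative
is uniformly `α`-Hölder. Only the values of `f` on the closure of `Ω` matter. -/
structure MemC2 {n : ℕ} {F : Type*} [NormedAddCommGroup F] [NormedSpace ℝ F]
    (α : ℝ≥0) (Ω : Set (RVec n)) (f : RVec n → F) : Prop where
  contDiffOn : ContDiffOn ℝ 2 f Ω
  continuousOn : ContinuousOn f (closure Ω)
  extends_fderiv : ∃ D : RVec n → (RVec n →L[ℝ] F),
    ContinuousOn D (closure Ω) ∧ EqOn D (fderiv ℝ f) Ω
  extends_fderiv_fderiv : ∃ D : RVec n → (RVec n →L[ℝ] RVec n →L[ℝ] F),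
    ContinuousOn D (closure Ω) ∧ EqOn D (fderiv ℝ (fderiv ℝ f)) Ω
  holder : ∃ C : ℝ≥0, HolderOnWith C α (fderiv ℝ (fderiv ℝ f)) Ω

/-- `Ω` is a bounded domain (open and connected) of class `C^{2,α}`: near each boundary point it
is the negativity set of a `C^{2,α}` function without critical points. -/
structure IsC2Domain {n : ℕ} (α : ℝ≥0) (Ω : Set (RVec n)) : Prop where
  isOpen : IsOpen Ω
  isConnected : IsConnected Ω
  isBounded : Bornology.IsBounded Ω
  boundary : ∀ x ∈ frontier Ω, ∃ U : Set (RVec n), IsOpen U ∧ x ∈ U ∧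
    ∃ ρ : RVec n → ℝ, MemC2 α U ρ ∧ (∀ y ∈ U, fderiv ℝ ρ y ≠ 0) ∧
      ∀ y ∈ U, y ∈ Ω ↔ ρ y < 0

/-- `ν` is the outer unit normal to `Ω` at the boundary point `x`: the normalized gradient of a
local defining function which is negative exactly inside `Ω`. -/
def IsOuterUnitNormal {n : ℕ} (Ω : Set (RVec n)) (x ν : RVec n) : Prop :=
  ∃ ρ : RVec n → ℝ, ContDiffAt ℝ 1 ρ x ∧ ∇ ρ x ≠ 0 ∧ (∀ᶠ y in 𝓝 x, y ∈ Ω ↔ ρ y < 0) ∧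
    ν = ‖∇ ρ x‖⁻¹ • ∇ ρ x

/-- The outer unit normal field `ν(x)` (meaningful at boundary points of a `C¹` domain). -/
def outerNormal {n : ℕ} (Ω : Set (RVec n)) (x : RVec n) : RVec n :=
  Classical.epsilon (IsOuterUnitNormal Ω x)

/-! ### Conductivities -/

/-- The closed band `ℝ + i[-R₀, R₀]` in `ℂ`. -/
def band (R₀ : ℝ) : Set ℂ := {z | |z.im| ≤ R₀}

/-- The gradient `∇_p a (s, p)` (complex partial derivatives in the variables `p₁, …, pₙ`). -/
def gradP {n : ℕ} (a : ℂ → CVec n → ℂ) (s : ℂ) (p : CVec n) : CVec n :=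
  WithLp.toLp 2 fun i => fderiv ℂ (a s) p (EuclideanSpace.single i 1)

/-- The derivative `∂_s a (s, p)`. -/
def derivS {n : ℕ} (a : ℂ → CVec n → ℂ) (s : ℂ) (p : CVec n) : ℂ :=
  deriv (fun z => a z p) s

/-- The conductivity depends only on `(s, p)`, and is positive for all real arguments. -/
def HypH1 {n : ℕ} (a : ℝ → RVec n → ℝ) : Prop := ∀ s p, 0 < a s p

/-- `ac` is an analytic continuation of the real conductivity `a` to the product of the band
`ℝ + i[-R₀, R₀]` and the ball `B_{r₀}(0)` of `ℂⁿ`. The values of `ac` elsewhere are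
irrelevant. -/
def HypH2 {n : ℕ} (R₀ r₀ : ℝ) (a : ℝ → RVec n → ℝ) (ac : ℂ → CVec n → ℂ) : Prop :=
  AnalyticOn ℂ (fun z : ℂ × CVec n => ac z.1 z.2) (band R₀ ×ˢ ball (0 : CVec n) r₀) ∧
    ∀ (s : ℝ) (p : RVec n), ‖p‖ < r₀ → ac (s : ℂ) (toC p) = (a s p : ℂ)

/-- The bounds `0 < λ̃ ≤ λ(s,p) ≤ Re a(s,p)` and `|a(s,p)| + |∇_p a(s,p)| ≤ Λ(s,p)`
with continuous functions `λ < Λ`. -/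
def HypH3 {n : ℕ} (R₀ r₀ : ℝ) (ac : ℂ → CVec n → ℂ) : Prop :=
  ∃ (lam0 : ℝ) (lam Lam : ℂ × CVec n → ℝ), 0 < lam0 ∧
    ContinuousOn lam (band R₀ ×ˢ ball (0 : CVec n) r₀) ∧
    ContinuousOn Lam (band R₀ ×ˢ ball (0 : CVec n) r₀) ∧
    ∀ s ∈ band R₀, ∀ p ∈ ball (0 : CVec n) r₀,
      lam0 ≤ lam (s, p) ∧ lam (s, p) < Lam (s, p) ∧ lam (s, p) ≤ (ac s p).re ∧
        ‖ac s p‖ + ‖gradP ac s p‖ ≤ Lam (s, p)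

/-! ### The linearized problem and its Dirichlet-to-Neumann map -/

/-- The affine function `u_{s,p}(x) = s + x · p`. -/
def affineU {n : ℕ} (s : ℝ) (p : CVec n) (x : RVec n) : ℂ := (s : ℂ) + cdot (toC x) p

/-- The gradient of a complex-valued function on `ℝⁿ`. -/
def grad {n : ℕ} (v : RVec n → ℂ) (x : RVec n) : CVec n :=
  WithLp.toLp 2 fun i => fderiv ℝ v x (EuclideanSpace.single i 1)

/-- The divergence of a complex vector field on `ℝⁿ`. -/
def divergence {n : ℕ} (G : RVec n → CVec n) (x : RVec n) : ℂ :=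
  ∑ i, fderiv ℝ (fun y => G y i) x (EuclideanSpace.single i 1)

/-- The linearized current at `x`, for a function with value `w` and gradient `ξ` there:
`a(u_{s,p},p) ξ + p {∇_p a(u_{s,p},p) · ξ + ∂_s a(u_{s,p},p) w}`. -/
def current {n : ℕ} (ac : ℂ → CVec n → ℂ) (s : ℝ) (p : CVec n) (x : RVec n)
    (w : ℂ) (ξ : CVec n) : CVec n :=
  ac (affineU s p x) p • ξ +
    (cdot (gradP ac (affineU s p x) p) ξ + derivS ac (affineU s p x) p * w) • p

/-- `v ∈ C^{2,α}` of the closure solves the linearized Dirichlet problem with boundary data `h`. -/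
def IsLinSolution {n : ℕ} (α : ℝ≥0) (Ω : Set (RVec n)) (ac : ℂ → CVec n → ℂ)
    (s : ℝ) (p : CVec n) (h v : RVec n → ℂ) : Prop :=
  MemC2 α Ω v ∧
    (∀ x ∈ Ω, divergence (fun y => current ac s p y (v y) (grad v y)) x = 0) ∧
    ∀ x ∈ frontier Ω, v x = h x

/-- The boundary current `[a ∇v + p {∇_p a · ∇v + ∂_s a v}] · ν` on `∂Ω`, where the gradient of
`v` on `∂Ω` is its continuous extension from `Ω`. -/
def conormal {n : ℕ} (Ω : Set (RVec n)) (ac : ℂ → CVec n → ℂ)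
    (s : ℝ) (p : CVec n) (v : RVec n → ℂ) (x : frontier Ω) : ℂ :=
  cdot (current ac s p x (v x) (extendFrom Ω (grad v) x)) (toC (outerNormal Ω x))

/-- The linearized Dirichlet-to-Neumann map, as a set-valued map: the set of boundary currents on
`∂Ω` of all solutions of the linearized Dirichlet problem with data `h`. It has exactly one
element whenever that problem is uniquely solvable. -/
def linDN {n : ℕ} (α : ℝ≥0) (Ω : Set (RVec n)) (ac : ℂ → CVec n → ℂ)
    (s : ℝ) (p : CVec n) (h : RVec n → ℂ) : Set (frontier Ω → ℂ) :=
  {g | ∃ v, IsLinSolution α Ω ac s p h v ∧ g = conormal Ω ac s p v}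

/-- `𝒜(r) = {p ∈ ℂⁿ : |p| < r, p · p = 0}`. -/
def isotropicCone (n : ℕ) (r : ℝ) : Set (CVec n) := {p | ‖p‖ < r ∧ cdot p p = 0}

/-- `𝒞(r) = {p ∈ ℂⁿ : |p| < r, p · p = 0, p · ν(0) ≠ 0}`. -/
def transversalCone {n : ℕ} (Ω : Set (RVec n)) (r : ℝ) : Set (CVec n) :=
  {p | ‖p‖ < r ∧ cdot p p = 0 ∧ cdot p (toC (outerNormal Ω 0)) ≠ 0}

end QuasilinearCalderon

end

/-! The argument tests the linearized problem with one explicit solution. If `p · p = 0`, then along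
`v(x) = x · p` the current has the form `H(x · p) p` with `H` holomorphic, so its divergence is
`H'(x · p) (p · p) = 0` whatever the conductivity (`isLinSolution_dotCLM`). Its boundary current at
the origin is `(a + p · ∇_p a)(s, p) (p · ν(0))` (`conormal_zero`).

Equality of the set-valued maps only says that some solution of the second problem has the boundary
current of `x · p` for the first. For small `p` the second problem is a small perturbation of `a₂(s,
0) Δ`, and an energy estimate with Poincaré's inequality (`eq_zero_of_divergence_eq_zero`) shows
that this solution is `x · p` itself. Dividing by `p · ν(0) ≠ 0` shows that `a + p · ∇_p a` is the
same for both conductivities on small transversal isotropic vectors.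

On a complex ray `z ↦ z p` this quantity is the derivative of `z a(s, z p)`. Hence `z (a₁ - a₂)(s, z
p)` has zero derivative near the vertex, so by the identity theorem wherever `|z p| < r₀`; it
vanishes at `z = 0`, hence at `z = 1`. Analyticity in `s` then passes from the real axis to the band
(`eqOn_band_of_eq_ofReal`).

The energy estimate uses no regularity of `∂Ω`: test functions are soft-thresholded, which gives
them compact support in `Ω`, and the threshold tends to zero. -/

noncomputable section

namespace QuasilinearCalderon

open MeasureTheory

/-! ### Soft thresholding. -/

section Cutoff

/-- The derivative of the `C¹` soft threshold at level `ε`. -/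
def softDeriv (ε t : ℝ) : ℝ := 1 - ε ^ 2 / max (t ^ 2) (ε ^ 2)

/-- A `C¹` soft threshold: it vanishes on `[-ε, ε]` and tends to the identity as `ε → 0`. -/
def soft (ε t : ℝ) : ℝ := ∫ τ in (0 : ℝ)..t, softDeriv ε τ

lemma continuous_softDeriv {ε : ℝ} (hε : 0 < ε) : Continuous (softDeriv ε) := by
  unfold softDeriv
  refine continuous_const.sub (continuous_const.div (by fun_prop) fun t => ?_)
  have : 0 < max (t ^ 2) (ε ^ 2) := lt_max_of_lt_right (by positivity)
  exact this.ne'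

lemma softDeriv_nonneg {ε : ℝ} (hε : 0 < ε) (t : ℝ) : 0 ≤ softDeriv ε t := by
  have : 0 < max (t ^ 2) (ε ^ 2) := lt_max_of_lt_right (by positivity)
  rw [softDeriv, sub_nonneg, div_le_one this]
  exact le_max_right _ _

lemma softDeriv_le_one (ε t : ℝ) : softDeriv ε t ≤ 1 := by
  have : 0 ≤ ε ^ 2 / max (t ^ 2) (ε ^ 2) := by positivity
  rw [softDeriv]; linarith

lemma abs_softDeriv_le_one {ε : ℝ} (hε : 0 < ε) (t : ℝ) : |softDeriv ε t| ≤ 1 := by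
  rw [abs_of_nonneg (softDeriv_nonneg hε t)]; exact softDeriv_le_one ε t

lemma softDeriv_eq_zero {ε t : ℝ} (hε : 0 < ε) (ht : |t| ≤ ε) : softDeriv ε t = 0 := by
  have : t ^ 2 ≤ ε ^ 2 := by rw [← sq_abs]; gcongr
  rw [softDeriv, max_eq_right this, div_self (by positivity), sub_self]

lemma hasDerivAt_soft {ε : ℝ} (hε : 0 < ε) (t : ℝ) : HasDerivAt (soft ε) (softDeriv ε t) t :=
  intervalIntegral.integral_hasDerivAt_right ((continuous_softDeriv hε).intervalIntegrable _ _)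
    ((continuous_softDeriv hε).stronglyMeasurableAtFilter _ _) (continuous_softDeriv hε).continuousAt

lemma continuous_soft {ε : ℝ} (hε : 0 < ε) : Continuous (soft ε) :=
  continuous_iff_continuousAt.2 fun t => (hasDerivAt_soft hε t).continuousAt

lemma contDiff_soft {ε : ℝ} (hε : 0 < ε) : ContDiff ℝ 1 (soft ε) := by
  rw [contDiff_one_iff_deriv]
  refine ⟨fun t => (hasDerivAt_soft hε t).differentiableAt, ?_⟩
  rw [funext fun t => (hasDerivAt_soft hε t).deriv]
  exact continuous_softDeriv hε

lemma soft_eq_zero {ε t : ℝ} (hε : 0 < ε) (ht : |t| ≤ ε) : soft ε t = 0 := by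
  rw [soft, intervalIntegral.integral_congr (g := fun _ => 0)]
  · simp
  · intro τ hτ
    refine softDeriv_eq_zero hε (le_trans ?_ ht)
    simpa using abs_sub_left_of_mem_uIcc hτ

lemma abs_soft_le {ε : ℝ} (hε : 0 < ε) (t : ℝ) : |soft ε t| ≤ |t| := by
  have := intervalIntegral.norm_integral_le_of_norm_le_const (a := 0) (b := t) (C := 1)
    (f := softDeriv ε) fun x _ => abs_softDeriv_le_one hε x
  simpa [soft] using this

/-- At `t = 0` the limit is `0` instead; `ae_fderiv_apply_eq_zero` makes that exception harmless. -/
lemma tendsto_softDeriv {t : ℝ} (ht : t ≠ 0) :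
    Tendsto (fun ε => softDeriv ε t) (𝓝[>] 0) (𝓝 1) := by
  have h : ContinuousAt (fun ε => softDeriv ε t) 0 := by
    unfold softDeriv
    refine continuousAt_const.sub (ContinuousAt.div (by fun_prop) (by fun_prop) ?_)
    have : 0 < max (t ^ 2) ((0 : ℝ) ^ 2) := lt_max_of_lt_left (by positivity)
    exact this.ne'
  have h' := h.tendsto
  simp only [softDeriv, ne_eq, OfNat.ofNat_ne_zero, not_false_eq_true, zero_pow, zero_div,
    sub_zero] at h'
  exact h'.mono_left nhdsWithin_le_nhds

lemma tendsto_soft (t : ℝ) : Tendsto (fun ε => soft ε t) (𝓝[>] 0) (𝓝 t) := by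
  have h : Tendsto (fun ε => soft ε t) (𝓝[>] 0) (𝓝 (∫ _ in (0 : ℝ)..t, (1 : ℝ))) := by
    refine intervalIntegral.tendsto_integral_filter_of_dominated_convergence (fun _ => 1) ?_ ?_
      (by simp) ?_
    · filter_upwards [self_mem_nhdsWithin] with ε hε
      exact (continuous_softDeriv hε).aestronglyMeasurable
    · filter_upwards [self_mem_nhdsWithin] with ε hε
      exact Eventually.of_forall fun x _ => abs_softDeriv_le_one hε x
    · filter_upwards [compl_mem_ae_iff.2 (measure_singleton (0 : ℝ))] with x hx _
      exact tendsto_softDeriv hx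
  simpa using h

end Cutoff

/-! ### Derivatives on zero sets. -/

section ZeroSet

variable {E : Type*} [NormedAddCommGroup E] [NormedSpace ℝ E] [FiniteDimensional ℝ E]
  [MeasurableSpace E] [BorelSpace E]

/-- The derivative of a differentiable function vanishes almost everywhere on its zero set. -/
lemma ae_fderiv_apply_eq_zero (μ : Measure E) [μ.IsAddHaarMeasure] {Ω : Set E} (hΩ : IsOpen Ω)
    {u : E → ℝ} (hu : DifferentiableOn ℝ u Ω) (e : E) :
    ∀ᵐ x ∂μ, x ∈ Ω → u x = 0 → fderiv ℝ u x e = 0 := by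
  have hmeas : MeasurableSet {x | x ∈ Ω → u x = 0 → fderiv ℝ u x e = 0} := by
    have h1 : IsOpen (Ω ∩ u ⁻¹' {0}ᶜ) :=
      hu.continuousOn.isOpen_inter_preimage hΩ isOpen_compl_singleton
    have h2 : MeasurableSet {x | fderiv ℝ u x e = 0} :=
      measurable_fderiv_apply_const ℝ u e (measurableSet_singleton 0)
    convert (hΩ.measurableSet.compl.union h1.measurableSet).union h2 using 1
    ext x
    simp only [mem_ofPred_eq, mem_union, mem_compl_iff, mem_inter_iff, mem_preimage,
      mem_singleton_iff]
    tauto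
  -- By Fubini it is enough to look at each line in the direction `e`. There a zero with nonzero
  -- derivative is isolated among the zeros, so the bad parameters form a discrete, hence countable,
  -- subset of `ℝ`.
  refine ae_mem_of_ae_add_linearMap_mem (LinearMap.toSpanSingleton ℝ E e) volume μ hmeas
    fun y => ?_
  set S : Set ℝ := {t | y + t • e ∈ Ω ∧ u (y + t • e) = 0 ∧ fderiv ℝ u (y + t • e) e ≠ 0}
    with hS
  have hdisc : DiscreteTopology S := by
    rw [discreteTopology_subtype_iff]
    rintro t ⟨h1, h2, h3⟩
    have hd : HasDerivAt (fun t : ℝ => u (y + t • e)) (fderiv ℝ u (y + t • e) e) t := by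
      have hl : HasDerivAt (fun t : ℝ => y + t • e) e t := by
        simpa using ((hasDerivAt_id t).smul_const e).const_add y
      exact (hu.differentiableAt (hΩ.mem_nhds h1)).hasFDerivAt.comp_hasDerivAt t hl
    rw [← Filter.empty_mem_iff_bot]
    filter_upwards [mem_inf_of_left (hd.eventually_ne (c := 0) h3),
      mem_inf_of_right (mem_principal_self S)] with z hz hz'
    exact hz hz'.2.1
  have hcount : S.Countable :=
    (TopologicalSpace.separableSpace_iff_countable (α := S)).1 inferInstance
  filter_upwards [compl_mem_ae_iff.2 (hcount.measure_zero volume)] with t ht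
  intro h1 h2
  by_contra h3
  exact ht ⟨h1, h2, h3⟩

end ZeroSet

end QuasilinearCalderon

namespace QuasilinearCalderon

open MeasureTheory

/-! ### Integration by parts and Poincaré's inequality. -/

section IntegrationByParts

lemma integrableOn_of_eq_zero_off_compact {E : Type*} [NormedAddCommGroup E] [MeasurableSpace E]
    [BorelSpace E] {Ω : Set E} (μ : Measure E) [IsFiniteMeasureOnCompacts μ]
    {K : Set E} (hΩ : IsOpen Ω) (hK : IsCompact K)
    (hKΩ : K ⊆ Ω) {f : E → ℝ} (hf : ContinuousOn f Ω) (h0 : ∀ x ∈ Ω, x ∉ K → f x = 0) :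
    IntegrableOn f Ω μ :=
  ((hf.mono hKΩ).integrableOn_compact hK).of_forall_sdiff_eq_zero hΩ.measurableSet
    fun x hx => h0 x hx.1 hx.2

/-- A superlevel set of a function that vanishes on the frontier is compact inside the domain. -/
lemma isCompact_superlevel {E : Type*} [PseudoMetricSpace E] [ProperSpace E]
    {Ω : Set E} {u : E → ℝ} (hb : Bornology.IsBounded Ω)
    (huc : ContinuousOn u (closure Ω)) (hu0 : ∀ x ∈ frontier Ω, u x = 0) {ε : ℝ} (hε : 0 < ε) :
    ∃ K ⊆ Ω, IsCompact K ∧ ∀ x ∈ Ω, x ∉ K → |u x| ≤ ε := by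
  refine ⟨closure Ω ∩ (fun x => |u x|) ⁻¹' Ici ε, ?_, ?_, ?_⟩
  · rintro x ⟨hx, hx'⟩
    by_contra hxΩ
    have : x ∈ frontier Ω := ⟨hx, fun h => hxΩ (interior_subset h)⟩
    rw [mem_preimage, hu0 x this, abs_zero, mem_Ici] at hx'
    linarith
  · exact hb.isCompact_closure.of_isClosed_subset
      (huc.abs.preimage_isClosed_of_isClosed isClosed_closure isClosed_Ici) inter_subset_left
  · intro x hx hxK
    by_contra! h
    exact hxK ⟨subset_closure hx, h.le⟩

variable {E : Type*} [NormedAddCommGroup E] [NormedSpace ℝ E] [FiniteDimensional ℝ E]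
  [MeasurableSpace E] [BorelSpace E] {Ω : Set E} {u : E → ℝ}

/-- Integration by parts against the soft threshold of a function vanishing on the frontier. -/
lemma integral_softDeriv_mul (μ : Measure E) [μ.IsAddHaarMeasure] (hΩ : IsOpen Ω)
    (hb : Bornology.IsBounded Ω)
    (hu : ContDiffOn ℝ 1 u Ω) (huc : ContinuousOn u (closure Ω))
    (hu0 : ∀ x ∈ frontier Ω, u x = 0) {G : E → ℝ} (hG : ContDiffOn ℝ 1 G Ω) (e : E)
    {ε : ℝ} (hε : 0 < ε) :
    IntegrableOn (fun x => softDeriv ε (u x) * (fderiv ℝ u x e * G x)) Ω μ ∧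
    IntegrableOn (fun x => soft ε (u x) * fderiv ℝ G x e) Ω μ ∧
    ∫ x in Ω, softDeriv ε (u x) * (fderiv ℝ u x e * G x) ∂μ =
      -∫ x in Ω, soft ε (u x) * fderiv ℝ G x e ∂μ := by
  obtain ⟨K, hKΩ, hK, hoff⟩ := isCompact_superlevel hb huc hu0 hε
  have hdu : ContinuousOn (fun x => fderiv ℝ u x e) Ω :=
    (hu.continuousOn_fderiv_of_isOpen hΩ le_rfl).clm_apply continuousOn_const
  have hdG : ContinuousOn (fun x => fderiv ℝ G x e) Ω :=
    (hG.continuousOn_fderiv_of_isOpen hΩ le_rfl).clm_apply continuousOn_const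
  have hsd := (continuous_softDeriv hε).comp_continuousOn hu.continuousOn
  have hs := (continuous_soft hε).comp_continuousOn hu.continuousOn
  have hA : IntegrableOn (fun x => softDeriv ε (u x) * (fderiv ℝ u x e * G x)) Ω μ :=
    integrableOn_of_eq_zero_off_compact μ hΩ hK hKΩ (hsd.mul (hdu.mul hG.continuousOn))
      fun x hx hxK => by simp [softDeriv_eq_zero hε (hoff x hx hxK)]
  have hB : IntegrableOn (fun x => soft ε (u x) * fderiv ℝ G x e) Ω μ :=
    integrableOn_of_eq_zero_off_compact μ hΩ hK hKΩ (hs.mul hdG)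
      fun x hx hxK => by simp [soft_eq_zero hε (hoff x hx hxK)]
  have hC : IntegrableOn (fun x => soft ε (u x) * G x) Ω μ :=
    integrableOn_of_eq_zero_off_compact μ hΩ hK hKΩ (hs.mul hG.continuousOn)
      fun x hx hxK => by simp [soft_eq_zero hε (hoff x hx hxK)]
  refine ⟨hA, hB, ?_⟩
  -- Extension by zero is differentiable everywhere because the product already vanishes off the
  -- compact set `K` inside `Ω`.
  set Ψ : E → ℝ := Ω.indicator fun x => soft ε (u x) * G x with hΨ
  set D : E → ℝ := Ω.indicator fun x => softDeriv ε (u x) * (fderiv ℝ u x e * G x) +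
    soft ε (u x) * fderiv ℝ G x e with hD
  have hderiv : ∀ x, HasLineDerivAt ℝ Ψ (D x) x e := by
    intro x
    by_cases hx : x ∈ Ω
    · have hux := (hu.differentiableOn one_ne_zero).differentiableAt (hΩ.mem_nhds hx)
      have hGx := (hG.differentiableOn one_ne_zero).differentiableAt (hΩ.mem_nhds hx)
      have h1 := ((hasDerivAt_soft hε (u x)).comp_hasFDerivAt x hux.hasFDerivAt).mul
        hGx.hasFDerivAt
      have h2 : HasFDerivAt Ψ _ x := h1.congr_of_eventuallyEq (by
        filter_upwards [hΩ.mem_nhds hx] with y hy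
        simp [hΨ, indicator_of_mem hy])
      convert h2.hasLineDerivAt e using 1
      simp [hD, indicator_of_mem hx]
      ring
    · have hxK : x ∈ Kᶜ := fun h => hx (hKΩ h)
      have h2 : HasFDerivAt Ψ (0 : E →L[ℝ] ℝ) x :=
        (hasFDerivAt_const (0 : ℝ) x).congr_of_eventuallyEq (by
          filter_upwards [hK.isClosed.isOpen_compl.mem_nhds hxK] with y hy
          by_cases hyΩ : y ∈ Ω
          · simp [hΨ, indicator_of_mem hyΩ, soft_eq_zero hε (hoff y hyΩ hy)]
          · simp [hΨ, indicator_of_notMem hyΩ])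
      convert h2.hasLineDerivAt e using 1
      simp [hD, indicator_of_notMem hx]
  have hAB := hA.add hB
  -- Pairing with the constant `1` says that the integral of `D` is zero.
  have key := integral_bilinear_hasLineDerivAt_right_eq_neg_left_of_integrable (μ := μ)
    (f := fun _ : E => (1 : ℝ)) (f' := fun _ => 0) (g := Ψ) (g' := D) (v := e)
    (B := ContinuousLinearMap.mul ℝ ℝ) (by simp)
    (by simpa using! (integrable_indicator_iff hΩ.measurableSet).2 hAB)
    (by simpa using! (integrable_indicator_iff hΩ.measurableSet).2 hC)
    (fun x _ => (hasFDerivAt_const (1 : ℝ) x).hasLineDerivAt e) fun x _ => hderiv x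
  simp only [ContinuousLinearMap.mul_apply', one_mul, zero_mul, integral_zero, neg_zero, hD,
    integral_indicator hΩ.measurableSet] at key
  rw [integral_add hA hB] at key
  linarith

lemma integrableOn_of_continuousOn_of_bound (μ : Measure E) [IsFiniteMeasureOnCompacts μ]
    (hΩ : IsOpen Ω)
    (hb : Bornology.IsBounded Ω) {f : E → ℝ} (hf : ContinuousOn f Ω) {C : ℝ}
    (hC : ∀ x ∈ Ω, |f x| ≤ C) : IntegrableOn f Ω μ :=
  (integrableOn_const hb.measure_lt_top.ne (C := C)).mono'
    (hf.aestronglyMeasurable hΩ.measurableSet)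
    ((ae_restrict_iff' hΩ.measurableSet).2 (Eventually.of_forall hC))

/-- A bounded divergence-free field is orthogonal to gradients of functions vanishing on the
frontier. -/
lemma integral_sum_fderiv_mul_eq_zero {ι : Type*} [Fintype ι]
    (μ : Measure E) [μ.IsAddHaarMeasure] (hΩ : IsOpen Ω) (hb : Bornology.IsBounded Ω)
    (hu : ContDiffOn ℝ 1 u Ω) (huc : ContinuousOn u (closure Ω))
    (hu0 : ∀ x ∈ frontier Ω, u x = 0) {C : ℝ} (e : ι → E) {F : ι → E → ℝ}
    (hF : ∀ i, ContDiffOn ℝ 1 (F i) Ω)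
    (hC : ∀ x ∈ Ω, |∑ i, fderiv ℝ u x (e i) * F i x| ≤ C)
    (hdiv : ∀ x ∈ Ω, ∑ i, fderiv ℝ (F i) x (e i) = 0) :
    ∫ x in Ω, ∑ i, fderiv ℝ u x (e i) * F i x ∂μ = 0 := by
  have hcont : ContinuousOn (fun x => ∑ i, fderiv ℝ u x (e i) * F i x) Ω :=
    continuousOn_finsetSum _ fun i _ =>
      ((hu.continuousOn_fderiv_of_isOpen hΩ le_rfl).clm_apply continuousOn_const).mul
        (hF i).continuousOn
  have hlim : Tendsto (fun ε => ∫ x in Ω, softDeriv ε (u x) *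
      ∑ i, fderiv ℝ u x (e i) * F i x ∂μ) (𝓝[>] 0)
      (𝓝 (∫ x in Ω, ∑ i, fderiv ℝ u x (e i) * F i x ∂μ)) := by
    refine tendsto_integral_filter_of_dominated_convergence (fun _ => C) ?_ ?_
      (integrableOn_const hb.measure_lt_top.ne) ?_
    · filter_upwards [self_mem_nhdsWithin] with ε hε
      exact (((continuous_softDeriv hε).comp_continuousOn hu.continuousOn).mul
        hcont).aestronglyMeasurable hΩ.measurableSet
    · filter_upwards [self_mem_nhdsWithin] with ε hε
      refine (ae_restrict_iff' hΩ.measurableSet).2 (Eventually.of_forall fun x hx => ?_)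
      rw [norm_mul]
      exact (mul_le_of_le_one_left (norm_nonneg _) (abs_softDeriv_le_one hε _)).trans (hC x hx)
    -- Where `u = 0` the factor `softDeriv` does not tend to `1`, but almost everywhere there the
    -- derivatives of `u` vanish.
    · rw [ae_restrict_iff' hΩ.measurableSet]
      filter_upwards [ae_all_iff.2 fun i =>
        ae_fderiv_apply_eq_zero μ hΩ (hu.differentiableOn one_ne_zero) (e i)] with x hx hxΩ
      by_cases hux : u x = 0
      · simp [hx _ hxΩ hux]
      · simpa using (tendsto_softDeriv hux).mul_const (∑ i, fderiv ℝ u x (e i) * F i x)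
  refine tendsto_nhds_unique hlim (tendsto_const_nhds.congr' ?_)
  filter_upwards [self_mem_nhdsWithin] with ε hε
  have h := fun i => integral_softDeriv_mul μ hΩ hb hu huc hu0 (hF i) (e i) hε
  simp_rw [Finset.mul_sum]
  rw [integral_finsetSum _ fun i _ => (h i).1]
  simp_rw [fun i => (h i).2.2]
  rw [Finset.sum_neg_distrib, ← integral_finsetSum _ fun i _ => (h i).2.1]
  rw [setIntegral_congr_fun hΩ.measurableSet (g := fun _ => 0)]
  · simp
  · intro x hx
    simp only [← Finset.mul_sum, hdiv x hx, mul_zero]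

/-- Poincaré's inequality on a domain that is bounded in the direction `e`. -/
lemma poincare (μ : Measure E) [μ.IsAddHaarMeasure] (hΩ : IsOpen Ω) (hb : Bornology.IsBounded Ω)
    (hu : ContDiffOn ℝ 1 u Ω) (huc : ContinuousOn u (closure Ω))
    (hu0 : ∀ x ∈ frontier Ω, u x = 0) {C : ℝ} {e : E}
    (hC : ∀ x ∈ Ω, |fderiv ℝ u x e| ≤ C) {ℓ : E →L[ℝ] ℝ} (hℓ : ℓ e = 1) {R : ℝ}
    (hR : ∀ x ∈ Ω, |ℓ x| ≤ R) :
    ∫ x in Ω, u x ^ 2 ∂μ ≤ 4 * R ^ 2 * ∫ x in Ω, fderiv ℝ u x e ^ 2 ∂μ := by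
  have hdu : ContinuousOn (fun x => fderiv ℝ u x e) Ω :=
    (hu.continuousOn_fderiv_of_isOpen hΩ le_rfl).clm_apply continuousOn_const
  have hdu2 : IntegrableOn (fun x => fderiv ℝ u x e ^ 2) Ω μ :=
    integrableOn_of_continuousOn_of_bound μ hΩ hb (hdu.pow 2) (C := C ^ 2) fun x hx => by
      rw [abs_pow]; exact pow_le_pow_left₀ (abs_nonneg _) (hC x hx) 2
  have hu2 : IntegrableOn (fun x => u x ^ 2) Ω μ :=
    ((huc.pow 2).integrableOn_compact hb.isCompact_closure).mono_set subset_closure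
  have hlim : Tendsto (fun ε => ∫ x in Ω, soft ε (u x) ^ 2 ∂μ) (𝓝[>] 0)
      (𝓝 (∫ x in Ω, u x ^ 2 ∂μ)) := by
    refine tendsto_integral_filter_of_dominated_convergence (fun x => u x ^ 2) ?_ ?_ hu2 ?_
    · filter_upwards [self_mem_nhdsWithin] with ε hε
      exact (((continuous_soft hε).comp_continuousOn hu.continuousOn).pow
        2).aestronglyMeasurable hΩ.measurableSet
    · filter_upwards [self_mem_nhdsWithin] with ε hε
      refine Eventually.of_forall fun x => ?_
      rw [norm_pow, Real.norm_eq_abs, ← sq_abs (u x)]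
      exact pow_le_pow_left₀ (abs_nonneg _) (abs_soft_le hε _) 2
    · exact Eventually.of_forall fun x => (tendsto_soft (u x)).pow 2
  refine le_of_tendsto hlim ?_
  filter_upwards [self_mem_nhdsWithin] with ε hε
  -- As `ℓ` has derivative `1` along `e`, testing with `ℓ · soft ε u` produces the integral of
  -- `(soft ε u)²`, equal to `-2` times a term linear in the derivative of `u`.
  have hG : ContDiffOn ℝ 1 (fun x => ℓ x * soft ε (u x)) Ω :=
    ℓ.contDiff.contDiffOn.mul ((contDiff_soft hε).comp_contDiffOn hu)
  obtain ⟨hA, hB, hAB⟩ := integral_softDeriv_mul μ hΩ hb hu huc hu0 hG e hε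
  have hs2 : IntegrableOn (fun x => soft ε (u x) ^ 2) Ω μ := by
    refine hu2.mono' ((((continuous_soft hε).comp_continuousOn hu.continuousOn).pow
        2).aestronglyMeasurable hΩ.measurableSet) (Eventually.of_forall fun x => ?_)
    rw [norm_pow, Real.norm_eq_abs, ← sq_abs (u x)]
    exact pow_le_pow_left₀ (abs_nonneg _) (abs_soft_le hε _) 2
  have hBeq : ∫ x in Ω, soft ε (u x) * fderiv ℝ (fun x => ℓ x * soft ε (u x)) x e ∂μ =
      ∫ x in Ω, (soft ε (u x) ^ 2 +
        softDeriv ε (u x) * (fderiv ℝ u x e * (ℓ x * soft ε (u x)))) ∂μ := by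
    refine setIntegral_congr_fun hΩ.measurableSet fun x hx => ?_
    have hux := (hu.differentiableOn one_ne_zero).differentiableAt (hΩ.mem_nhds hx)
    have h1 : HasFDerivAt (fun x => ℓ x * soft ε (u x)) _ x := ℓ.hasFDerivAt.mul
      ((hasDerivAt_soft hε (u x)).comp_hasFDerivAt x hux.hasFDerivAt)
    simp only [h1.fderiv]
    simp [hℓ]
    ring
  rw [hBeq, integral_add hs2 hA] at hAB
  -- Young's inequality with weights `1/2` and `2`; absorbing the first term doubles `2 R²` into the
  -- constant `4 R²`.
  have hle : -(2 * ∫ x in Ω, softDeriv ε (u x) * (fderiv ℝ u x e * (ℓ x * soft ε (u x))) ∂μ) ≤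
      ∫ x in Ω, (2⁻¹ * soft ε (u x) ^ 2 + 2 * R ^ 2 * fderiv ℝ u x e ^ 2) ∂μ := by
    rw [← integral_const_mul, ← integral_neg]
    refine setIntegral_mono_on (hA.const_mul 2).neg
      ((hs2.const_mul _).add (hdu2.const_mul _)) hΩ.measurableSet fun x hx => ?_
    have h1 := hR x hx
    have h2 := abs_softDeriv_le_one hε (u x)
    set a := soft ε (u x)
    set b := fderiv ℝ u x e
    set c := softDeriv ε (u x)
    have h3 : (c * ℓ x) ^ 2 ≤ R ^ 2 := by
      rw [← sq_abs, abs_mul]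
      refine pow_le_pow_left₀ (by positivity) ?_ 2
      calc |c| * |ℓ x| ≤ 1 * R := by gcongr
        _ = R := one_mul R
    nlinarith [sq_nonneg (a + 2 * (c * ℓ x) * b), mul_le_mul_of_nonneg_right h3 (sq_nonneg b)]
  rw [integral_add (hs2.const_mul _) (hdu2.const_mul _), integral_const_mul,
    integral_const_mul] at hle
  linarith

end IntegrationByParts

end QuasilinearCalderon

namespace QuasilinearCalderon

open MeasureTheory

/-! ### The energy estimate for complex fields. -/

section Energy

variable {n : ℕ} {Ω : Set (RVec n)}

lemma fderiv_re_apply {f : RVec n → ℂ} {x : RVec n} (hf : DifferentiableAt ℝ f x) (e : RVec n) :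
    fderiv ℝ (fun y => (f y).re) x e = (fderiv ℝ f x e).re := by
  have h : HasFDerivAt (fun y => (f y).re) (Complex.reCLM ∘L fderiv ℝ f x) x :=
    Complex.reCLM.hasFDerivAt.comp x hf.hasFDerivAt
  rw [h.fderiv]
  rfl

lemma fderiv_im_apply {f : RVec n → ℂ} {x : RVec n} (hf : DifferentiableAt ℝ f x) (e : RVec n) :
    fderiv ℝ (fun y => (f y).im) x e = (fderiv ℝ f x e).im := by
  have h : HasFDerivAt (fun y => (f y).im) (Complex.imCLM ∘L fderiv ℝ f x) x :=
    Complex.imCLM.hasFDerivAt.comp x hf.hasFDerivAt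
  rw [h.fderiv]
  rfl

lemma contDiffOn_re {f : RVec n → ℂ} {k : WithTop ℕ∞} (hf : ContDiffOn ℝ k f Ω) :
    ContDiffOn ℝ k (fun y => (f y).re) Ω :=
  Complex.reCLM.contDiff.comp_contDiffOn hf

lemma contDiffOn_im {f : RVec n → ℂ} {k : WithTop ℕ∞} (hf : ContDiffOn ℝ k f Ω) :
    ContDiffOn ℝ k (fun y => (f y).im) Ω :=
  Complex.imCLM.contDiff.comp_contDiffOn hf

lemma norm_grad_sq (w : RVec n → ℂ) (x : RVec n) :
    ‖grad w x‖ ^ 2 = ∑ i, ((fderiv ℝ w x (EuclideanSpace.single i 1)).re ^ 2 +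
      (fderiv ℝ w x (EuclideanSpace.single i 1)).im ^ 2) := by
  rw [EuclideanSpace.norm_sq_eq]
  refine Finset.sum_congr rfl fun i _ => ?_
  rw [Complex.sq_norm, Complex.normSq_apply]
  simp only [grad]
  ring

lemma continuousOn_grad (hΩ : IsOpen Ω) {w : RVec n → ℂ} (hw : ContDiffOn ℝ 1 w Ω) :
    ContinuousOn (grad w) Ω :=
  (PiLp.continuous_toLp 2 _).comp_continuousOn <| continuousOn_pi.2 fun _ =>
    (hw.continuousOn_fderiv_of_isOpen hΩ le_rfl).clm_apply continuousOn_const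

lemma norm_fderiv_single_le {w : RVec n → ℂ} {x : RVec n} (i : Fin n) :
    ‖fderiv ℝ w x (EuclideanSpace.single i 1)‖ ≤ ‖fderiv ℝ w x‖ := by
  simpa using (fderiv ℝ w x).le_opNorm (EuclideanSpace.single i 1)

lemma norm_sq_eq_re_im (z : ℂ) : ‖z‖ ^ 2 = z.re ^ 2 + z.im ^ 2 := by
  rw [Complex.sq_norm, Complex.normSq_apply]; ring

/-- The real part of the energy pairing with a bounded divergence-free complex field vanishes. -/
lemma integral_re_inner_grad_eq_zero (hΩ : IsOpen Ω) (hb : Bornology.IsBounded Ω)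
    {w : RVec n → ℂ} (hw : ContDiffOn ℝ 1 w Ω) (hwc : ContinuousOn w (closure Ω))
    (hw0 : ∀ x ∈ frontier Ω, w x = 0) {M : ℝ} (hM : ∀ x ∈ Ω, ‖fderiv ℝ w x‖ ≤ M)
    {F : RVec n → CVec n} (hF : ∀ i, ContDiffOn ℝ 1 (fun y => F y i) Ω) {C : ℝ}
    (hC : ∀ x ∈ Ω, ‖F x‖ ≤ C) (hdiv : ∀ x ∈ Ω, divergence F x = 0) :
    ∫ x in Ω, RCLike.re (inner ℂ (grad w x) (F x)) = 0 := by
  have hwd : ∀ x ∈ Ω, DifferentiableAt ℝ w x := fun x hx =>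
    (hw.differentiableOn one_ne_zero).differentiableAt (hΩ.mem_nhds hx)
  have hFd : ∀ i, ∀ x ∈ Ω, DifferentiableAt ℝ (fun y => F y i) x := fun i x hx =>
    ((hF i).differentiableOn one_ne_zero).differentiableAt (hΩ.mem_nhds hx)
  have hbound : ∀ x ∈ Ω, ∀ f g : Fin n → ℝ,
      (∀ i, |f i| ≤ ‖fderiv ℝ w x (EuclideanSpace.single i 1)‖) → (∀ i, |g i| ≤ ‖F x i‖) →
      |∑ i, f i * g i| ≤ n * (M * C) := by
    intro x hx f g hf hg
    refine (Finset.abs_sum_le_sum_abs _ _).trans ?_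
    refine (Finset.sum_le_card_nsmul _ _ (M * C) fun i _ => ?_).trans (by simp)
    rw [abs_mul]
    exact mul_le_mul ((hf i).trans ((norm_fderiv_single_le i).trans (hM x hx)))
      ((hg i).trans ((PiLp.norm_apply_le (F x) i).trans (hC x hx))) (abs_nonneg _)
      ((norm_nonneg _).trans (hM x hx))
  have hre : ∀ x ∈ Ω, |∑ i, fderiv ℝ (fun y => (w y).re) x (EuclideanSpace.single i 1) *
      (F x i).re| ≤ n * (M * C) := fun x hx =>
    hbound x hx _ _ (fun i => by rw [fderiv_re_apply (hwd x hx)]; exact Complex.abs_re_le_norm _)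
      fun i => Complex.abs_re_le_norm _
  have him : ∀ x ∈ Ω, |∑ i, fderiv ℝ (fun y => (w y).im) x (EuclideanSpace.single i 1) *
      (F x i).im| ≤ n * (M * C) := fun x hx =>
    hbound x hx _ _ (fun i => by rw [fderiv_im_apply (hwd x hx)]; exact Complex.abs_im_le_norm _)
      fun i => Complex.abs_im_le_norm _
  -- The real part of the Hermitian pairing splits into real-with-real and imaginary-with-imaginary
  -- terms, and both parts of `F` are divergence-free.
  have h1 := integral_sum_fderiv_mul_eq_zero volume hΩ hb (contDiffOn_re hw)
    (Complex.continuous_re.comp_continuousOn hwc) (fun x hx => by simp [hw0 x hx])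
    (fun i : Fin n => EuclideanSpace.single i (1 : ℝ)) (fun i => contDiffOn_re (hF i)) hre
    fun x hx => by
      simp only [fun i => fderiv_re_apply (hFd i x hx)]
      rw [← Complex.re_sum]
      exact congrArg Complex.re (hdiv x hx)
  have h2 := integral_sum_fderiv_mul_eq_zero volume hΩ hb (contDiffOn_im hw)
    (Complex.continuous_im.comp_continuousOn hwc) (fun x hx => by simp [hw0 x hx])
    (fun i : Fin n => EuclideanSpace.single i (1 : ℝ)) (fun i => contDiffOn_im (hF i)) him
    fun x hx => by
      simp only [fun i => fderiv_im_apply (hFd i x hx)]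
      rw [← Complex.im_sum]
      exact congrArg Complex.im (hdiv x hx)
  have hint : ∀ {f : RVec n → ℝ} {g : Fin n → RVec n → ℝ}, ContDiffOn ℝ 1 f Ω →
      (∀ i, ContDiffOn ℝ 1 (g i) Ω) →
      (∀ x ∈ Ω, |∑ i, fderiv ℝ f x (EuclideanSpace.single i 1) * g i x| ≤ n * (M * C)) →
      IntegrableOn (fun x => ∑ i, fderiv ℝ f x (EuclideanSpace.single i 1) * g i x) Ω :=
    fun hf hg hfg => integrableOn_of_continuousOn_of_bound volume hΩ hb
      (continuousOn_finsetSum _ fun i _ =>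
        ((hf.continuousOn_fderiv_of_isOpen hΩ le_rfl).clm_apply continuousOn_const).mul
        (hg i).continuousOn) hfg
  have h3 := integral_add (hint (contDiffOn_re hw) (fun i => contDiffOn_re (hF i)) hre)
    (hint (contDiffOn_im hw) (fun i => contDiffOn_im (hF i)) him)
  rw [h1, h2, add_zero] at h3
  rw [← h3]
  refine setIntegral_congr_fun hΩ.measurableSet fun x hx => ?_
  simp only [PiLp.inner_apply, map_sum, ← Finset.sum_add_distrib, fderiv_re_apply (hwd x hx),
    fderiv_im_apply (hwd x hx)]
  refine Finset.sum_congr rfl fun i _ => ?_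
  simp [grad, RCLike.inner_apply]
  ring

/-- Uniqueness for divergence-form equations that are small perturbations of a multiple of the
Laplacian. -/
lemma eq_zero_of_divergence_eq_zero (hΩ : IsOpen Ω) (hb : Bornology.IsBounded Ω)
    {w : RVec n → ℂ} (hw : ContDiffOn ℝ 1 w Ω) (hwc : ContinuousOn w (closure Ω))
    (hw0 : ∀ x ∈ frontier Ω, w x = 0) {M : ℝ} (hM : ∀ x ∈ Ω, ‖fderiv ℝ w x‖ ≤ M)
    {F : RVec n → CVec n} (hF : ∀ i, ContDiffOn ℝ 1 (fun y => F y i) Ω)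
    (hdiv : ∀ x ∈ Ω, divergence F x = 0) {a δ R : ℝ} (hδ : 0 ≤ δ)
    (hFδ : ∀ x ∈ Ω, ‖F x - (a : ℂ) • grad w x‖ ≤ δ * (‖grad w x‖ + ‖w x‖))
    (i₀ : Fin n) (hR : ∀ x ∈ Ω, ‖x‖ ≤ R) (hsmall : δ * (3 / 2 + 2 * R ^ 2) < a) :
    ∀ x ∈ Ω, w x = 0 := by
  have hwd : ∀ x ∈ Ω, DifferentiableAt ℝ w x := fun x hx =>
    (hw.differentiableOn one_ne_zero).differentiableAt (hΩ.mem_nhds hx)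
  have hgrad : ∀ x ∈ Ω, ‖grad w x‖ ^ 2 ≤ n * (2 * M ^ 2) := by
    intro x hx
    rw [norm_grad_sq]
    refine (Finset.sum_le_card_nsmul _ _ (2 * M ^ 2) fun i _ => ?_).trans (by simp)
    rw [← norm_sq_eq_re_im]
    have := pow_le_pow_left₀ (norm_nonneg _)
      ((norm_fderiv_single_le (w := w) (x := x) i).trans (hM x hx)) 2
    nlinarith [sq_nonneg M]
  have hgrad' : ∀ x ∈ Ω, ‖grad w x‖ ≤ √(n * (2 * M ^ 2)) := fun x hx =>
    Real.le_sqrt_of_sq_le (hgrad x hx)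
  obtain ⟨W, hW⟩ := hb.isCompact_closure.exists_bound_of_continuousOn hwc
  have hg2 : IntegrableOn (fun x => ‖grad w x‖ ^ 2) Ω :=
    integrableOn_of_continuousOn_of_bound volume hΩ hb ((continuousOn_grad hΩ hw).norm.pow 2)
      fun x hx => by rw [abs_of_nonneg (sq_nonneg _)]; exact hgrad x hx
  have hw2 : IntegrableOn (fun x => ‖w x‖ ^ 2) Ω :=
    ((hwc.norm.pow 2).integrableOn_compact hb.isCompact_closure).mono_set subset_closure
  have hFb : ∀ x ∈ Ω, ‖F x‖ ≤ δ * (√(n * (2 * M ^ 2)) + W) + |a| * √(n * (2 * M ^ 2)) := by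
    intro x hx
    calc ‖F x‖ = ‖(F x - (a : ℂ) • grad w x) + (a : ℂ) • grad w x‖ := by rw [sub_add_cancel]
      _ ≤ δ * (‖grad w x‖ + ‖w x‖) + |a| * ‖grad w x‖ := by
        refine (norm_add_le _ _).trans (add_le_add (hFδ x hx) ?_)
        rw [norm_smul, Complex.norm_real, Real.norm_eq_abs]
      _ ≤ _ := by
        gcongr
        · exact hgrad' x hx
        · exact hW x (subset_closure hx)
        · exact hgrad' x hx
  have hzero := integral_re_inner_grad_eq_zero hΩ hb hw hwc hw0 hM hF hFb hdiv
  have hFc : ContinuousOn F Ω :=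
    (PiLp.continuous_toLp 2 _).comp_continuousOn <| continuousOn_pi.2 fun i => (hF i).continuousOn
  have hinner : IntegrableOn (fun x => RCLike.re (inner ℂ (grad w x) (F x))) Ω :=
    integrableOn_of_continuousOn_of_bound volume hΩ hb
      (RCLike.continuous_re.comp_continuousOn ((continuousOn_grad hΩ hw).inner hFc))
      (C := √(n * (2 * M ^ 2)) * (δ * (√(n * (2 * M ^ 2)) + W) + |a| * √(n * (2 * M ^ 2))))
      fun x hx => (RCLike.abs_re_le_norm _).trans <| (norm_inner_le_norm _ _).trans <|
        mul_le_mul (hgrad' x hx) (hFb x hx) (norm_nonneg _) (Real.sqrt_nonneg _)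
  -- Coercivity: the error is at most `δ |∇w| (|∇w| + |w|)`, and `|∇w| |w| ≤ (|∇w|² + |w|²) / 2`
  -- gives the constants `3/2` and `1/2`.
  have hlower : ∫ x in Ω, ((a - δ * (3 / 2)) * ‖grad w x‖ ^ 2 - δ / 2 * ‖w x‖ ^ 2) ≤ 0 := by
    rw [← hzero]
    refine setIntegral_mono_on ((hg2.const_mul _).sub (hw2.const_mul _)) hinner
      hΩ.measurableSet fun x hx => ?_
    have h1 : inner ℂ (grad w x) (F x) = (a : ℂ) * inner ℂ (grad w x) (grad w x) +
        inner ℂ (grad w x) (F x - (a : ℂ) • grad w x) := by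
      rw [inner_sub_right, inner_smul_right]; ring
    have h2 : RCLike.re ((a : ℂ) * inner ℂ (grad w x) (grad w x)) = a * ‖grad w x‖ ^ 2 := by
      rw [inner_self_eq_norm_sq_to_K]
      simp [← Complex.ofReal_pow]
    have h3 := (RCLike.abs_re_le_norm (inner ℂ (grad w x) (F x - (a : ℂ) • grad w x))).trans
      ((norm_inner_le_norm _ _).trans
        (mul_le_mul_of_nonneg_left (hFδ x hx) (norm_nonneg (grad w x))))
    rw [h1, map_add, h2]
    have h4 := neg_le_of_abs_le h3
    nlinarith [mul_nonneg hδ (sq_nonneg (‖grad w x‖ - ‖w x‖))]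
  rw [integral_sub (hg2.const_mul _) (hw2.const_mul _), integral_const_mul,
    integral_const_mul] at hlower
  have hcoord : ∀ x ∈ Ω, |(EuclideanSpace.proj i₀ : RVec n →L[ℝ] ℝ) x| ≤ R :=
    fun x hx => (PiLp.norm_apply_le x i₀).trans (hR x hx)
  have hbd : ∀ x ∈ Ω, ‖fderiv ℝ w x (EuclideanSpace.single i₀ 1)‖ ≤ M :=
    fun x hx => (norm_fderiv_single_le i₀).trans (hM x hx)
  have hP1 := poincare volume hΩ hb (contDiffOn_re hw)
    (Complex.continuous_re.comp_continuousOn hwc) (fun x hx => by simp [hw0 x hx])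
    (e := EuclideanSpace.single i₀ (1 : ℝ)) (C := M) (fun x hx => by
      rw [fderiv_re_apply (hwd x hx)]
      exact (Complex.abs_re_le_norm _).trans (hbd x hx))
    (ℓ := EuclideanSpace.proj i₀) (by simp) hcoord
  have hP2 := poincare volume hΩ hb (contDiffOn_im hw)
    (Complex.continuous_im.comp_continuousOn hwc) (fun x hx => by simp [hw0 x hx])
    (e := EuclideanSpace.single i₀ (1 : ℝ)) (C := M) (fun x hx => by
      rw [fderiv_im_apply (hwd x hx)]
      exact (Complex.abs_im_le_norm _).trans (hbd x hx))
    (ℓ := EuclideanSpace.proj i₀) (by simp) hcoord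
  have hsq : ∀ {f : RVec n → ℝ}, ContinuousOn f (closure Ω) →
      IntegrableOn (fun x => f x ^ 2) Ω := fun hf =>
    ((hf.pow 2).integrableOn_compact hb.isCompact_closure).mono_set subset_closure
  have hdsq : ∀ {f : RVec n → ℝ}, ContDiffOn ℝ 1 f Ω →
      (∀ x ∈ Ω, |fderiv ℝ f x (EuclideanSpace.single i₀ 1)| ≤ M) →
      IntegrableOn (fun x => fderiv ℝ f x (EuclideanSpace.single i₀ 1) ^ 2) Ω := fun hf hfM =>
    integrableOn_of_continuousOn_of_bound volume hΩ hb
      (((hf.continuousOn_fderiv_of_isOpen hΩ le_rfl).clm_apply continuousOn_const).pow 2)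
      (C := M ^ 2) fun x hx => by
        rw [abs_pow]; exact pow_le_pow_left₀ (abs_nonneg _) (hfM x hx) 2
  have hP : ∫ x in Ω, ‖w x‖ ^ 2 ≤ 4 * R ^ 2 * ∫ x in Ω, ‖grad w x‖ ^ 2 := by
    have e1 : ∫ x in Ω, ‖w x‖ ^ 2 = (∫ x in Ω, (w x).re ^ 2) + ∫ x in Ω, (w x).im ^ 2 := by
      rw [← integral_add (hsq (f := fun x => (w x).re) (Complex.continuous_re.comp_continuousOn hwc))
        (hsq (f := fun x => (w x).im) (Complex.continuous_im.comp_continuousOn hwc))]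
      simp only [norm_sq_eq_re_im]
    have e2 : (∫ x in Ω, fderiv ℝ (fun y => (w y).re) x (EuclideanSpace.single i₀ 1) ^ 2) +
        ∫ x in Ω, fderiv ℝ (fun y => (w y).im) x (EuclideanSpace.single i₀ 1) ^ 2 ≤
        ∫ x in Ω, ‖grad w x‖ ^ 2 := by
      have i1 := hdsq (contDiffOn_re hw) (fun x hx => by
        rw [fderiv_re_apply (hwd x hx)]
        exact (Complex.abs_re_le_norm _).trans (hbd x hx))
      have i2 := hdsq (contDiffOn_im hw) (fun x hx => by
        rw [fderiv_im_apply (hwd x hx)]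
        exact (Complex.abs_im_le_norm _).trans (hbd x hx))
      rw [← integral_add i1 i2]
      refine setIntegral_mono_on (i1.add i2) hg2 hΩ.measurableSet fun x hx => ?_
      rw [fderiv_re_apply (hwd x hx), fderiv_im_apply (hwd x hx), norm_grad_sq]
      exact Finset.single_le_sum (f := fun i =>
        (fderiv ℝ w x (EuclideanSpace.single i 1)).re ^ 2 +
        (fderiv ℝ w x (EuclideanSpace.single i 1)).im ^ 2) (fun i _ => by positivity)
        (Finset.mem_univ i₀)
    nlinarith [sq_nonneg R]
  have hA0 : 0 ≤ ∫ x in Ω, ‖grad w x‖ ^ 2 := integral_nonneg fun x => sq_nonneg _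
  have hB0 : 0 ≤ ∫ x in Ω, ‖w x‖ ^ 2 := integral_nonneg fun x => sq_nonneg _
  set A := ∫ x in Ω, ‖grad w x‖ ^ 2
  set B := ∫ x in Ω, ‖w x‖ ^ 2 with hBdef
  have hA : A ≤ 0 := by
    have := mul_le_mul_of_nonneg_left hP (by linarith : 0 ≤ δ / 2)
    -- Poincaré bounds `δ/2 · B` by `2 R² δ · A`, which is where the smallness condition on `δ`
    -- comes from.
    have h5 : (a - δ * (3 / 2 + 2 * R ^ 2)) * A ≤ 0 := by nlinarith
    exact nonpos_of_mul_nonpos_right h5 (by linarith)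
  have hB : B = 0 := by
    refine le_antisymm (hP.trans ?_) hB0
    rw [le_antisymm hA hA0, mul_zero]
  rw [hBdef, setIntegral_eq_zero_iff_of_nonneg_ae (Eventually.of_forall fun x => sq_nonneg _)
    hw2] at hB
  refine Measure.eqOn_open_of_ae_eq (f := w) (g := fun _ => 0) (μ := volume) ?_ hΩ
    hw.continuousOn continuousOn_const
  filter_upwards [hB] with x hx
  simpa using hx

end Energy

end QuasilinearCalderon

namespace QuasilinearCalderon

/-! ### The bilinear product and the functions `x · p`. -/

section Algebra

variable {n : ℕ}

lemma norm_cdot_le (p q : CVec n) : ‖cdot p q‖ ≤ ‖p‖ * ‖q‖ := by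
  rw [EuclideanSpace.norm_eq, EuclideanSpace.norm_eq]
  refine (norm_sum_le _ _).trans ?_
  simp only [norm_mul]
  exact Real.sum_mul_le_sqrt_mul_sqrt _ _ _

@[simp] lemma toC_apply (x : RVec n) (i : Fin n) : toC x i = (x i : ℂ) := rfl

lemma norm_toC (x : RVec n) : ‖toC x‖ = ‖x‖ := by
  simp [EuclideanSpace.norm_eq]

lemma cdot_sub_right (p q q' : CVec n) : cdot p (q - q') = cdot p q - cdot p q' := by
  simp [cdot, mul_sub, Finset.sum_sub_distrib]

lemma cdot_smul_left (c : ℂ) (p q : CVec n) : cdot (c • p) q = c * cdot p q := by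
  simp [cdot, Finset.mul_sum, mul_assoc]

lemma cdot_smul_right (c : ℂ) (p q : CVec n) : cdot p (c • q) = c * cdot p q := by
  simp [cdot, Finset.mul_sum, mul_left_comm]

/-- The real-linear map `x ↦ x · p`. -/
def dotCLM (p : CVec n) : RVec n →L[ℝ] ℂ :=
  LinearMap.toContinuousLinearMap
    { toFun := fun x => cdot (toC x) p
      map_add' := fun x y => by simp [cdot, add_mul, Finset.sum_add_distrib]
      map_smul' := fun c x => by simp [cdot, Finset.mul_sum, mul_assoc] }

lemma dotCLM_apply (p : CVec n) (x : RVec n) : dotCLM p x = cdot (toC x) p := rfl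

lemma dotCLM_single (p : CVec n) (i : Fin n) : dotCLM p (EuclideanSpace.single i 1) = p i := by
  simp [dotCLM_apply, cdot, PiLp.single_apply, apply_ite Complex.ofReal]

lemma norm_dotCLM_apply_le (p : CVec n) (x : RVec n) : ‖dotCLM p x‖ ≤ ‖x‖ * ‖p‖ := by
  rw [dotCLM_apply, ← norm_toC x]; exact norm_cdot_le _ _

lemma affineU_eq (s : ℝ) (p : CVec n) (x : RVec n) : affineU s p x = s + dotCLM p x := rfl

lemma memC2_clm (α : ℝ≥0) (Ω : Set (RVec n)) (L : RVec n →L[ℝ] ℂ) : MemC2 α Ω L := by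
  have h1 : fderiv ℝ L = fun _ => L := funext fun x => L.fderiv
  have h2 : fderiv ℝ (fderiv ℝ L) = fun _ => 0 := by
    rw [h1]; exact funext fun x => fderiv_const_apply L
  refine ⟨L.contDiff.contDiffOn, L.continuous.continuousOn, ⟨fun _ => L, continuousOn_const, ?_⟩,
    ⟨fun _ => 0, continuousOn_const, ?_⟩, ⟨0, ?_⟩⟩
  · rw [h1]; exact fun _ _ => rfl
  · rw [h2]; exact fun _ _ => rfl
  · rw [h2]; intro x _ y _; simp

lemma grad_dotCLM (p : CVec n) : grad (dotCLM p) = fun _ => p := by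
  ext x i
  simp [grad, dotCLM_single]

end Algebra

/-! ### Regularity and size of the coefficients. -/

section Coefficients

variable {n : ℕ} {ac : ℂ → CVec n → ℂ} {U : Set (ℂ × CVec n)}

/-- The open product domain on which the conductivities are jointly analytic. -/
def analyticDomain (n : ℕ) (R₀ r₀ : ℝ) : Set (ℂ × CVec n) := {z | |z.im| < R₀} ×ˢ ball 0 r₀

lemma isOpen_analyticDomain (R₀ r₀ : ℝ) : IsOpen (analyticDomain n R₀ r₀) :=
  (isOpen_lt (by fun_prop) continuous_const).prod isOpen_ball

lemma HypH2.analyticOnNhd {R₀ r₀ : ℝ} {a : ℝ → RVec n → ℝ} (h : HypH2 R₀ r₀ a ac) :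
    AnalyticOnNhd ℂ (fun z : ℂ × CVec n => ac z.1 z.2) (analyticDomain n R₀ r₀) := by
  rw [← (isOpen_analyticDomain R₀ r₀).analyticOn_iff_analyticOnNhd]
  exact h.1.mono (prod_mono (fun z (hz : |z.im| < R₀) => hz.le) subset_rfl)

/-- Partial derivatives as values of the joint derivative, so that they inherit joint analyticity in
`(s, p)`. -/
lemma gradP_apply_eq (h : AnalyticOnNhd ℂ (fun z : ℂ × CVec n => ac z.1 z.2) U) {z : ℂ}
    {q : CVec n} (hz : (z, q) ∈ U) (i : Fin n) :
    gradP ac z q i =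
      fderiv ℂ (fun z : ℂ × CVec n => ac z.1 z.2) (z, q) (0, EuclideanSpace.single i 1) := by
  have h1 : HasFDerivAt (ac z) _ q := (h _ hz).differentiableAt.hasFDerivAt.comp q
    (hasFDerivAt_prodMk_right z q)
  rw [gradP, h1.fderiv]
  simp

lemma derivS_eq (h : AnalyticOnNhd ℂ (fun z : ℂ × CVec n => ac z.1 z.2) U) {z : ℂ}
    {q : CVec n} (hz : (z, q) ∈ U) :
    derivS ac z q = fderiv ℂ (fun z : ℂ × CVec n => ac z.1 z.2) (z, q) (1, 0) := by
  have h1 : HasFDerivAt ((fun z : ℂ × CVec n => ac z.1 z.2) ∘ fun e => (e, q)) _ z :=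
    HasFDerivAt.comp z (h _ hz).differentiableAt.hasFDerivAt (hasFDerivAt_prodMk_left z q)
  change deriv ((fun z : ℂ × CVec n => ac z.1 z.2) ∘ fun e => (e, q)) z = _
  rw [h1.hasDerivAt.deriv]
  simp

lemma analyticOnNhd_gradP (hU : IsOpen U)
    (h : AnalyticOnNhd ℂ (fun z : ℂ × CVec n => ac z.1 z.2) U) (i : Fin n) :
    AnalyticOnNhd ℂ (fun z : ℂ × CVec n => gradP ac z.1 z.2 i) U :=
  AnalyticOnNhd.congr hU ((ContinuousLinearMap.apply ℂ ℂ
    ((0 : ℂ), EuclideanSpace.single i (1 : ℂ))).comp_analyticOnNhd h.fderiv)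
    fun _ hz => (gradP_apply_eq h hz i).symm

lemma analyticOnNhd_derivS (hU : IsOpen U)
    (h : AnalyticOnNhd ℂ (fun z : ℂ × CVec n => ac z.1 z.2) U) :
    AnalyticOnNhd ℂ (fun z : ℂ × CVec n => derivS ac z.1 z.2) U :=
  AnalyticOnNhd.congr hU ((ContinuousLinearMap.apply ℂ ℂ
    ((1 : ℂ), (0 : CVec n))).comp_analyticOnNhd h.fderiv)
    fun _ hz => (derivS_eq h hz).symm

lemma continuousOn_gradP (hU : IsOpen U)
    (h : AnalyticOnNhd ℂ (fun z : ℂ × CVec n => ac z.1 z.2) U) :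
    ContinuousOn (fun z : ℂ × CVec n => gradP ac z.1 z.2) U :=
  (PiLp.continuous_toLp 2 _).comp_continuousOn <| continuousOn_pi.2 fun i =>
    (analyticOnNhd_gradP hU h i).continuousOn

/-- Restriction of an analytic coefficient to the values of the affine function `u_{s,p}`. -/
lemma contDiffOn_comp_affineU {f : ℂ × CVec n → ℂ} (hf : AnalyticOnNhd ℂ f U)
    {Ω : Set (RVec n)} {s : ℝ} {p : CVec n} (hU : ∀ x ∈ Ω, (affineU s p x, p) ∈ U) :
    ContDiffOn ℝ 1 (fun x => f (affineU s p x, p)) Ω := by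
  intro x hx
  have h1 : ContDiffAt ℝ 1 f (affineU s p x, p) := (hf _ (hU x hx)).contDiffAt.restrict_scalars ℝ
  have h2 : ContDiffAt ℝ 1 (fun x => (affineU s p x, p)) x := by
    simp only [affineU_eq]
    exact (contDiffAt_const.add (dotCLM p).contDiff.contDiffAt).prodMk contDiffAt_const
  exact (h1.comp x h2).contDiffWithinAt

lemma contDiffOn_current (hU : IsOpen U)
    (h : AnalyticOnNhd ℂ (fun z : ℂ × CVec n => ac z.1 z.2) U) {Ω : Set (RVec n)}
    (hΩ : IsOpen Ω) {s : ℝ} {p : CVec n} (hmem : ∀ x ∈ Ω, (affineU s p x, p) ∈ U)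
    {v : RVec n → ℂ} (hv : ContDiffOn ℝ 2 v Ω) (i : Fin n) :
    ContDiffOn ℝ 1 (fun x => current ac s p x (v x) (grad v x) i) Ω := by
  have hg : ∀ j, ContDiffOn ℝ 1 (fun x => grad v x j) Ω := fun j =>
    (hv.fderiv_of_isOpen hΩ (m := 1) (by norm_num)).clm_apply contDiffOn_const
  simp only [current, cdot, PiLp.add_apply, PiLp.smul_apply, smul_eq_mul]
  exact ((contDiffOn_comp_affineU h hmem).mul (hg i)).add
    (((ContDiffOn.sum fun j _ =>
      (contDiffOn_comp_affineU (analyticOnNhd_gradP hU h j) hmem).mul (hg j)).add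
      ((contDiffOn_comp_affineU (analyticOnNhd_derivS hU h) hmem).mul
        (hv.of_le (by norm_num)))).mul contDiffOn_const)

lemma current_sub (s : ℝ) (p : CVec n) (x : RVec n) (w w' : ℂ) (ξ ξ' : CVec n) :
    current ac s p x (w - w') (ξ - ξ') = current ac s p x w ξ - current ac s p x w' ξ' := by
  simp only [current, cdot_sub_right, smul_sub, mul_sub]
  module

/-- Apart from `a(u, p) ξ`, every term of the current carries a factor `p`, so small `p` makes the
current close to that of a constant multiple of the Laplacian. -/
lemma norm_current_sub_le (s : ℝ) (p : CVec n) (x : RVec n) (w a : ℂ) (ξ : CVec n) {δ : ℝ}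
    (h : ‖ac (affineU s p x) p - a‖ +
      (‖gradP ac (affineU s p x) p‖ + ‖derivS ac (affineU s p x) p‖) * ‖p‖ ≤ δ) :
    ‖current ac s p x w ξ - a • ξ‖ ≤ δ * (‖ξ‖ + ‖w‖) := by
  have e : current ac s p x w ξ - a • ξ = (ac (affineU s p x) p - a) • ξ +
    (cdot (gradP ac (affineU s p x) p) ξ + derivS ac (affineU s p x) p * w) • p := by
    rw [current, sub_smul]; abel
  rw [e]
  set A := ‖ac (affineU s p x) p - a‖ with hA
  set G := ‖gradP ac (affineU s p x) p‖ with hG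
  set D := ‖derivS ac (affineU s p x) p‖ with hD
  calc _ ≤ A * ‖ξ‖ + (G * ‖ξ‖ + D * ‖w‖) * ‖p‖ := by
        refine (norm_add_le _ _).trans ?_
        rw [norm_smul, norm_smul]
        gcongr
        refine (norm_add_le _ _).trans (add_le_add (norm_cdot_le _ _) (norm_mul _ _).le)
    _ = (A + G * ‖p‖) * ‖ξ‖ + (D * ‖p‖) * ‖w‖ := by ring
    _ ≤ δ * ‖ξ‖ + δ * ‖w‖ := by
        have : 0 ≤ A := norm_nonneg _
        have : 0 ≤ G * ‖p‖ := by positivity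
        have : 0 ≤ D * ‖p‖ := by positivity
        gcongr <;> nlinarith
    _ = _ := by ring

end Coefficients

/-! ### The linearized problem for small `p`. -/

section LinearizedProblem

variable {n : ℕ} {ac : ℂ → CVec n → ℂ} {R₀ r₀ : ℝ} {Ω : Set (RVec n)} {α : ℝ≥0}

/-- For small `p` the coefficients along `u_{s,p}` are within `δ` of the Laplacian's. -/
lemma exists_radius_coeff_le (hR₀ : 0 < R₀) (hr₀ : 0 < r₀)
    (h : AnalyticOnNhd ℂ (fun z : ℂ × CVec n => ac z.1 z.2) (analyticDomain n R₀ r₀))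
    (hb : Bornology.IsBounded Ω) (s : ℝ) {δ : ℝ} (hδ : 0 < δ) :
    ∃ ρ > 0, ∀ p : CVec n, ‖p‖ < ρ → ∀ x ∈ Ω, (affineU s p x, p) ∈ analyticDomain n R₀ r₀ ∧
      ‖ac (affineU s p x) p - ac s 0‖ +
      (‖gradP ac (affineU s p x) p‖ + ‖derivS ac (affineU s p x) p‖) * ‖p‖ ≤ δ := by
  have hU := isOpen_analyticDomain (n := n) R₀ r₀
  have hmem : ((s : ℂ), (0 : CVec n)) ∈ analyticDomain n R₀ r₀ := by
    simp [analyticDomain, hR₀, hr₀]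
  have hnhds := hU.mem_nhds hmem
  have hc : ContinuousAt (fun z : ℂ × CVec n => ‖ac z.1 z.2 - ac s 0‖ +
      (‖gradP ac z.1 z.2‖ + ‖derivS ac z.1 z.2‖) * ‖z.2‖) (s, 0) := by
    refine ((h.continuousOn.continuousAt hnhds).sub continuousAt_const).norm.add
      ((((continuousOn_gradP hU h).continuousAt hnhds).norm.add
      (((analyticOnNhd_derivS hU h).continuousOn).continuousAt hnhds).norm).mul ?_)
    fun_prop
  -- The expression is continuous near `(s, 0)` and vanishes there.
  have hev := hc.eventually_lt (continuousAt_const (y := δ)) (by simpa using hδ)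
  obtain ⟨η, hη, hball⟩ := Metric.eventually_nhds_iff.1 (hev.and hnhds)
  obtain ⟨R, hR0, hR⟩ := hb.exists_pos_norm_le
  -- This radius keeps both `|p|` and `|x · p| ≤ R |p|` below `η`.
  refine ⟨η / (R + 1), by positivity, fun p hp x hx => ?_⟩
  have hp' : ‖p‖ * (R + 1) < η := (lt_div_iff₀ (by positivity)).1 hp
  have h1 : ‖p‖ < η := by nlinarith [norm_nonneg p]
  have h2 : ‖dotCLM p x‖ < η := by
    refine (norm_dotCLM_apply_le p x).trans_lt ?_
    nlinarith [norm_nonneg p, mul_le_mul_of_nonneg_right (hR x hx) (norm_nonneg p)]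
  have := @hball (affineU s p x, p) (by
    rw [Prod.dist_eq, max_lt_iff]
    simp [affineU_eq, dist_eq_norm, h1, h2])
  exact ⟨this.2, this.1.le⟩

lemma MemC2.exists_bound_fderiv {v : RVec n → ℂ} (hb : Bornology.IsBounded Ω)
    (hv : MemC2 α Ω v) : ∃ M, ∀ x ∈ Ω, ‖fderiv ℝ v x‖ ≤ M := by
  obtain ⟨D, hD, hDv⟩ := hv.extends_fderiv
  obtain ⟨M, hM⟩ := hb.isCompact_closure.exists_bound_of_continuousOn hD
  exact ⟨M, fun x hx => hDv hx ▸ hM x (subset_closure hx)⟩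

/-- Unique solvability of the linearized Dirichlet problem for small `p`. -/
lemma exists_radius_isLinSolution_unique (hn : 0 < n) (hΩ : IsOpen Ω)
    (hb : Bornology.IsBounded Ω) (hR₀ : 0 < R₀) (hr₀ : 0 < r₀)
    (h : AnalyticOnNhd ℂ (fun z : ℂ × CVec n => ac z.1 z.2) (analyticDomain n R₀ r₀))
    {s a : ℝ} (ha : 0 < a) (hsa : ac s 0 = a) :
    ∃ ρ > 0, ∀ p : CVec n, ‖p‖ < ρ → ∀ f v v' : RVec n → ℂ,
      IsLinSolution α Ω ac s p f v → IsLinSolution α Ω ac s p f v' → EqOn v v' Ω := by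
  have hU := isOpen_analyticDomain (n := n) R₀ r₀
  obtain ⟨R, hR0, hR⟩ := hb.exists_pos_norm_le
  -- Chosen so that `δ (3/2 + 2 R²) = a / 2 < a`.
  set δ : ℝ := a / 2 / (3 / 2 + 2 * R ^ 2) with hδ
  have hδ0 : 0 < δ := by positivity
  obtain ⟨ρ, hρ, hcoef⟩ := exists_radius_coeff_le hR₀ hr₀ h hb s hδ0
  refine ⟨ρ, hρ, fun p hp f v v' hv hv' x hx => ?_⟩
  have hmem : ∀ x ∈ Ω, (affineU s p x, p) ∈ analyticDomain n R₀ r₀ := fun x hx =>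
    (hcoef p hp x hx).1
  have hdv : ∀ x ∈ Ω, DifferentiableAt ℝ v x := fun x hx =>
    (hv.1.contDiffOn.differentiableOn two_ne_zero).differentiableAt (hΩ.mem_nhds hx)
  have hdv' : ∀ x ∈ Ω, DifferentiableAt ℝ v' x := fun x hx =>
    (hv'.1.contDiffOn.differentiableOn two_ne_zero).differentiableAt (hΩ.mem_nhds hx)
  have hfd : ∀ x ∈ Ω, fderiv ℝ (fun x => v x - v' x) x = fderiv ℝ v x - fderiv ℝ v' x :=
    fun x hx => fderiv_fun_sub (hdv x hx) (hdv' x hx)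
  have hgrad : ∀ x ∈ Ω, grad (fun x => v x - v' x) x = grad v x - grad v' x := by
    intro x hx
    ext i
    simp [grad, hfd x hx]
  obtain ⟨M, hM⟩ := hv.1.exists_bound_fderiv hb
  obtain ⟨M', hM'⟩ := hv'.1.exists_bound_fderiv hb
  have hw2 : ContDiffOn ℝ 2 (fun x => v x - v' x) Ω := hv.1.contDiffOn.sub hv'.1.contDiffOn
  have hcur := fun i => contDiffOn_current hU h hΩ hmem hv.1.contDiffOn i
  have hcur' := fun i => contDiffOn_current hU h hΩ hmem hv'.1.contDiffOn i
  have key := eq_zero_of_divergence_eq_zero hΩ hb (w := fun x => v x - v' x)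
    (hw2.of_le (by norm_num)) (hv.1.continuousOn.sub hv'.1.continuousOn)
    (fun x hx => by rw [hv.2.2 x hx, hv'.2.2 x hx, sub_self])
    (M := M + M') (fun x hx => by
      rw [hfd x hx]
      exact (norm_sub_le _ _).trans (add_le_add (hM x hx) (hM' x hx)))
    (F := fun x => current ac s p x (v x - v' x) (grad (fun x => v x - v' x) x))
    (fun i => contDiffOn_current hU h hΩ hmem hw2 i)
    (fun x hx => by
      have e : ∀ i, fderiv ℝ (fun y => current ac s p y (v y - v' y)
          (grad (fun x => v x - v' x) y) i) x =
          fderiv ℝ (fun y => current ac s p y (v y) (grad v y) i) x -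
          fderiv ℝ (fun y => current ac s p y (v' y) (grad v' y) i) x := by
        intro i
        rw [← fderiv_fun_sub
          (((hcur i).differentiableOn one_ne_zero).differentiableAt (hΩ.mem_nhds hx))
          (((hcur' i).differentiableOn one_ne_zero).differentiableAt (hΩ.mem_nhds hx))]
        refine Filter.EventuallyEq.fderiv_eq ?_
        filter_upwards [hΩ.mem_nhds hx] with y hy
        rw [hgrad y hy, current_sub, PiLp.sub_apply]
      have e1 := hv.2.1 x hx
      have e2 := hv'.2.1 x hx
      simp only [divergence] at e1 e2 ⊢
      simp only [e, sub_apply, Finset.sum_sub_distrib, e1, e2, sub_zero])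
    (a := a) hδ0.le (fun x hx => by
      rw [← hsa]
      exact norm_current_sub_le s p x _ _ _ (hcoef p hp x hx).2)
    ⟨0, hn⟩ hR (by
      rw [hδ, div_mul_cancel₀ _ (by positivity)]; linarith) x hx
  exact sub_eq_zero.1 key

/-- For isotropic `p` the function `x ↦ x · p` solves the linearized problem. -/
lemma isLinSolution_dotCLM
    (h : AnalyticOnNhd ℂ (fun z : ℂ × CVec n => ac z.1 z.2) (analyticDomain n R₀ r₀))
    {s : ℝ} {p : CVec n} (hmem : ∀ x ∈ Ω, (affineU s p x, p) ∈ analyticDomain n R₀ r₀)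
    (hp : cdot p p = 0) : IsLinSolution α Ω ac s p (dotCLM p) (dotCLM p) := by
  have hU := isOpen_analyticDomain (n := n) R₀ r₀
  refine ⟨memC2_clm α Ω _, fun x hx => ?_, fun _ _ => rfl⟩
  -- Along `x · p` the current is this holomorphic function of `x · p` times the fixed vector `p`.
  set H : ℂ → ℂ := fun z => ac (s + z) p + (cdot (gradP ac (s + z) p) p +
    derivS ac (s + z) p * z) with hH
  have hcomp : ∀ {f : ℂ × CVec n → ℂ}, AnalyticOnNhd ℂ f (analyticDomain n R₀ r₀) →
      DifferentiableAt ℂ (fun z : ℂ => f (s + z, p)) (dotCLM p x) := fun {f} hf =>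
    DifferentiableAt.comp (g := f) (f := fun z : ℂ => ((s : ℂ) + z, p)) (dotCLM p x)
      (hf _ (hmem x hx)).differentiableAt (by fun_prop)
  have hHd : DifferentiableAt ℂ H (dotCLM p x) :=
    (hcomp h).add (((DifferentiableAt.fun_sum fun i _ =>
      (hcomp (analyticOnNhd_gradP hU h i)).mul_const (p i))).add
      ((hcomp (analyticOnNhd_derivS hU h)).mul differentiableAt_id))
  have hcur : ∀ y, current ac s p y (dotCLM p y) (grad (dotCLM p) y) = H (dotCLM p y) • p := by
    intro y
    rw [grad_dotCLM, current, hH, affineU_eq, ← add_smul]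
  have hi : ∀ i, fderiv ℝ (fun y => current ac s p y (dotCLM p y) (grad (dotCLM p) y) i) x
      (EuclideanSpace.single i 1) = deriv H (dotCLM p x) * (p i * p i) := by
    intro i
    simp only [hcur, PiLp.smul_apply, smul_eq_mul]
    have h1 : HasFDerivAt (fun y => H (dotCLM p y)) _ x :=
      (hHd.hasFDerivAt.restrictScalars ℝ).comp x (dotCLM p).hasFDerivAt
    rw [(h1.mul_const (p i)).fderiv]
    have h2 : (fderiv ℂ H (dotCLM p x)) (p i) = p i * deriv H (dotCLM p x) := by
      rw [← toSpanSingleton_deriv]; simp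
    simp [dotCLM_single, h2]
    ring
  simp only [divergence, hi, ← Finset.mul_sum]
  rw [show ∑ i, p i * p i = cdot p p from rfl, hp, mul_zero]

/-- The extension depends only on values on `A`, so agreement inside `Ω` determines the boundary
gradient. -/
lemma extendFrom_congr {X Y : Type*} [TopologicalSpace X] [TopologicalSpace Y] {A : Set X}
    {f g : X → Y} (hfg : EqOn f g A) (x : X) : extendFrom A f x = extendFrom A g x := by
  unfold extendFrom limUnder
  rw [Filter.map_congr (hfg.eventuallyEq_of_mem self_mem_nhdsWithin)]

/-- The boundary current at the origin of a solution that agrees with `x ↦ x · p`. -/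
lemma conormal_zero (hΩ : IsOpen Ω) (h0 : (0 : RVec n) ∈ frontier Ω) {s : ℝ} {p : CVec n}
    {v : RVec n → ℂ} (hv : EqOn v (dotCLM p) Ω) (hv0 : v 0 = 0) :
    conormal Ω ac s p v ⟨0, h0⟩ =
      (ac s p + cdot (gradP ac s p) p) * cdot p (toC (outerNormal Ω 0)) := by
  have hg : EqOn (grad v) (fun _ => p) Ω := by
    intro x hx
    rw [← grad_dotCLM p]
    have : fderiv ℝ v x = fderiv ℝ (dotCLM p) x :=
      (hv.eventuallyEq_of_mem (hΩ.mem_nhds hx)).fderiv_eq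
    simp only [grad, this]
  have he : extendFrom Ω (grad v) 0 = p := by
    rw [extendFrom_congr hg]
    exact extendFrom_eq (frontier_subset_closure h0) tendsto_const_nhds
  -- At the origin `u_{s,p}` equals `s`, and the `∂_s a` term drops out because `v 0 = 0`.
  have hs : affineU s p 0 = s := by simp [affineU_eq]
  simp only [conormal, current, he, hv0, hs, mul_zero, add_zero, ← add_smul, cdot_smul_left]

end LinearizedProblem

end QuasilinearCalderon

namespace QuasilinearCalderon

/-! ### From boundary currents to the conductivities. -/

section Identification

variable {n : ℕ} {R₀ r₀ : ℝ} {Ω : Set (RVec n)} {α : ℝ≥0}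

lemma fderiv_apply_eq_cdot (ac : ℂ → CVec n → ℂ) (s : ℂ) (q p : CVec n) :
    fderiv ℂ (ac s) q p = cdot (gradP ac s q) p := by
  have hp : p = ∑ i, p i • EuclideanSpace.single i (1 : ℂ) := by
    ext j
    simp [Pi.single_apply]
  conv_lhs => rw [hp]
  simp [cdot, gradP, mul_comm]

/-- Equality of the linearized Dirichlet-to-Neumann maps near `p = 0` determines
`a + p · ∇_p a` on small transversal isotropic vectors. -/
lemma exists_radius_add_cdot_gradP_eq (hn : 0 < n) (hΩ : IsOpen Ω) (hb : Bornology.IsBounded Ω)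
    (h0 : (0 : RVec n) ∈ frontier Ω) (hR₀ : 0 < R₀) (hr₀ : 0 < r₀) {ac₁ ac₂ : ℂ → CVec n → ℂ}
    (h₁ : AnalyticOnNhd ℂ (fun z : ℂ × CVec n => ac₁ z.1 z.2) (analyticDomain n R₀ r₀))
    (h₂ : AnalyticOnNhd ℂ (fun z : ℂ × CVec n => ac₂ z.1 z.2) (analyticDomain n R₀ r₀))
    {s a : ℝ} (ha : 0 < a) (hsa : ac₂ s 0 = a)
    (hDN : ∃ ρ > 0, ∀ p ∈ isotropicCone n ρ, ∀ h : RVec n → ℂ, MemC2 α Ω h →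
      linDN α Ω ac₁ s p h = linDN α Ω ac₂ s p h) :
    ∃ ρ > 0, ∀ p ∈ transversalCone Ω ρ,
      ac₁ s p + cdot (gradP ac₁ s p) p = ac₂ s p + cdot (gradP ac₂ s p) p := by
  obtain ⟨ρ₁, hρ₁, hDN⟩ := hDN
  obtain ⟨ρ₂, hρ₂, huniq⟩ :=
    exists_radius_isLinSolution_unique (α := α) hn hΩ hb hR₀ hr₀ h₂ ha hsa
  -- The tolerance `1` is arbitrary: only membership in the analytic domain, common to both
  -- conductivities, is used.
  obtain ⟨ρ₃, hρ₃, hmem⟩ := exists_radius_coeff_le hR₀ hr₀ h₂ hb s one_pos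
  refine ⟨min ρ₁ (min ρ₂ ρ₃), by positivity, fun p hp => ?_⟩
  obtain ⟨hpρ, hpp, hpν⟩ := hp
  simp only [lt_min_iff] at hpρ
  have hm := fun x hx => (hmem p hpρ.2.2 x hx).1
  have hsol₁ := isLinSolution_dotCLM (α := α) h₁ hm hpp
  have hsol₂ := isLinSolution_dotCLM (α := α) h₂ hm hpp
  have hin : conormal Ω ac₁ s p (dotCLM p) ∈ linDN α Ω ac₂ s p (dotCLM p) :=
    hDN p ⟨hpρ.1, hpp⟩ _ (memC2_clm α Ω _) ▸ ⟨_, hsol₁, rfl⟩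
  obtain ⟨v, hv, hcon⟩ := hin
  have heq := huniq p hpρ.2.1 _ _ _ hv hsol₂
  have hval := congrFun hcon ⟨0, h0⟩
  rw [conormal_zero hΩ h0 (fun _ _ => rfl) (map_zero _),
    conormal_zero hΩ h0 heq ((hv.2.2 0 h0).trans (map_zero _))] at hval
  exact mul_right_cancel₀ hpν hval

/-- Propagation along complex rays from the vertex of the cone. -/
lemma eq_on_transversalCone_of_add_cdot_gradP_eq (hR₀ : 0 < R₀) (hr₀ : 0 < r₀)
    {ac₁ ac₂ : ℂ → CVec n → ℂ}
    (h₁ : AnalyticOnNhd ℂ (fun z : ℂ × CVec n => ac₁ z.1 z.2) (analyticDomain n R₀ r₀))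
    (h₂ : AnalyticOnNhd ℂ (fun z : ℂ × CVec n => ac₂ z.1 z.2) (analyticDomain n R₀ r₀))
    {s ρ : ℝ} (hρ : 0 < ρ) (heq : ∀ p ∈ transversalCone Ω ρ,
      ac₁ s p + cdot (gradP ac₁ s p) p = ac₂ s p + cdot (gradP ac₂ s p) p)
    {p : CVec n} (hp : p ∈ transversalCone Ω r₀) : ac₁ s p = ac₂ s p := by
  obtain ⟨hpr, hpp, hpν⟩ := hp
  set D : Set ℂ := (fun z : ℂ => z • p) ⁻¹' ball 0 r₀ with hD
  have hDo : IsOpen D := isOpen_ball.preimage (by fun_prop)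
  have hDc : IsPreconnected D :=
    ((convex_ball (0 : CVec n) r₀).is_linear_preimage
      ((LinearMap.toSpanSingleton ℂ (CVec n) p).restrictScalars ℝ).isLinear).isPreconnected
  have h0D : (0 : ℂ) ∈ D := by simp [hD, hr₀]
  have h1D : (1 : ℂ) ∈ D := by simpa [hD] using hpr
  have hmem : ∀ z ∈ D, ((s : ℂ), z • p) ∈ analyticDomain n R₀ r₀ := fun z hz =>
    ⟨by simpa using hR₀, hz⟩
  have han : ∀ {ac : ℂ → CVec n → ℂ},
      AnalyticOnNhd ℂ (fun z : ℂ × CVec n => ac z.1 z.2) (analyticDomain n R₀ r₀) →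
      AnalyticOnNhd ℂ (fun z : ℂ => ac s (z • p)) D := fun {ac} h z hz =>
    (h _ (hmem z hz)).fun_comp (f := fun z : ℂ => ((s : ℂ), z • p))
      (analyticAt_const.prod (analyticAt_id.smul analyticAt_const))
  have hder : ∀ {ac : ℂ → CVec n → ℂ},
      AnalyticOnNhd ℂ (fun z : ℂ × CVec n => ac z.1 z.2) (analyticDomain n R₀ r₀) →
      ∀ z ∈ D, HasDerivAt (fun z : ℂ => ac s (z • p)) (cdot (gradP ac s (z • p)) p) z := by
    intro ac h z hz
    have hd : DifferentiableAt ℂ (ac s) (z • p) :=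
      (h _ (hmem z hz)).differentiableAt.comp (z • p)
        (f := fun q : CVec n => ((s : ℂ), q)) (by fun_prop)
    rw [← fderiv_apply_eq_cdot]
    have hl : HasDerivAt (fun z : ℂ => z • p) p z := by
      simpa using (hasDerivAt_id z).smul_const p
    exact hd.hasFDerivAt.comp_hasDerivAt z hl
  set g : ℂ → ℂ := fun z => z * (ac₁ s (z • p) - ac₂ s (z • p)) with hg
  have hgan : AnalyticOnNhd ℂ g D := fun z hz =>
    analyticAt_id.mul ((han h₁ z hz).sub (han h₂ z hz))
  -- The derivative of `g` is the difference of the two values of `a + q · ∇_p a` at `q = z p`. The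
  -- point `z = 0` is excluded since `0` is not transversal.
  have hgder : ∀ᶠ z in 𝓝[≠] (0 : ℂ), deriv g z = 0 := by
    have hsmall : ∀ᶠ z in 𝓝 (0 : ℂ), ‖z • p‖ < ρ := by
      have hc : Continuous fun z : ℂ => ‖z • p‖ := by fun_prop
      exact hc.continuousAt.eventually_lt continuousAt_const (by simpa using hρ)
    filter_upwards [nhdsWithin_le_nhds hsmall, nhdsWithin_le_nhds (hDo.mem_nhds h0D),
      self_mem_nhdsWithin] with z hzρ hzD hz0
    have h3 := heq (z • p) ⟨hzρ, by simp [cdot_smul_left, cdot_smul_right, hpp], by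
      rw [cdot_smul_left]; exact mul_ne_zero hz0 hpν⟩
    have hgz : HasDerivAt g _ z :=
      (hasDerivAt_id z).mul ((hder h₁ z hzD).sub (hder h₂ z hzD))
    rw [hgz.deriv]
    simp only [cdot_smul_right] at h3
    simp only [id_eq]
    linear_combination h3
  have hg0 : EqOn (deriv g) 0 D :=
    hgan.deriv.eqOn_zero_of_preconnected_of_frequently_eq_zero hDc h0D hgder.frequently
  -- The factor `z` gives `g 0 = 0`, and `g 1` is the wanted difference.
  have := hDo.is_const_of_deriv_eq_zero hDc hgan.differentiableOn hg0 h1D h0D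
  simpa [hg, sub_eq_zero] using this

/-- Two functions analytic in the closed band that agree on the real axis agree on the band. -/
lemma eqOn_band_of_eq_ofReal (hR₀ : 0 < R₀) {f g : ℂ → ℂ} (hf : AnalyticOn ℂ f (band R₀))
    (hg : AnalyticOn ℂ g (band R₀)) (h : ∀ s : ℝ, f s = g s) : EqOn f g (band R₀) := by
  set S : Set ℂ := {z | |z.im| < R₀} with hS
  have hSo : IsOpen S := isOpen_lt (by fun_prop) continuous_const
  have hsub : S ⊆ band R₀ := fun z (hz : |z.im| < R₀) => hz.le
  have hSc : IsPreconnected S := by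
    have : S = Complex.imLm ⁻¹' Ioo (-R₀) R₀ := by
      ext z; simp [hS, abs_lt]
    rw [this]
    exact ((convex_Ioo _ _).linear_preimage _).isPreconnected
  have hfreq : ∃ᶠ z in 𝓝[≠] (0 : ℂ), f z = g z := by
    have ht : Tendsto (fun x : ℝ => (x : ℂ)) (𝓝[≠] 0) (𝓝[≠] 0) := by
      refine tendsto_nhdsWithin_iff.2 ⟨?_, ?_⟩
      · exact (Complex.continuous_ofReal.tendsto' 0 0 (by simp)).mono_left nhdsWithin_le_nhds
      · filter_upwards [self_mem_nhdsWithin] with x hx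
        simpa using hx
    exact ht.frequently (Eventually.of_forall h).frequently
  have hopen : EqOn f g S :=
    AnalyticOnNhd.eqOn_of_preconnected_of_frequently_eq
      ((hSo.analyticOn_iff_analyticOnNhd).1 (hf.mono hsub))
      ((hSo.analyticOn_iff_analyticOnNhd).1 (hg.mono hsub)) hSc (by simpa [hS] using hR₀) hfreq
  -- The edges of the band are reached by continuity, through `t z` with `t` increasing to `1`.
  refine hopen.of_subset_closure hf.continuousOn hg.continuousOn hsub fun z hz => ?_
  have hlim : Tendsto (fun t : ℝ => (t : ℂ) * z) (𝓝[<] 1) (𝓝 z) := by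
    have hc : Continuous fun t : ℝ => (t : ℂ) * z := by fun_prop
    exact (hc.tendsto' 1 z (by simp)).mono_left nhdsWithin_le_nhds
  refine mem_closure_of_tendsto hlim ?_
  filter_upwards [Ioo_mem_nhdsLT (zero_lt_one (α := ℝ))] with t ht
  have hz' : |z.im| ≤ R₀ := hz
  simp only [hS, mem_ofPred_eq, Complex.im_ofReal_mul, abs_mul, abs_of_pos ht.1]
  nlinarith [ht.1, ht.2, abs_nonneg z.im]

end Identification

end QuasilinearCalderon

end

open QuasilinearCalderon in
theorem theorem6p3 (n : ℕ) (hn : 2 ≤ n) (α : ℝ≥0) (hα₀ : 0 < α) (hα₁ : α < 1)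
    (Ω : Set (RVec n)) (hΩ : IsC2Domain α Ω) (h0 : (0 : RVec n) ∈ frontier Ω)
    (R₀ r₀ : ℝ) (hR₀ : 0 < R₀) (hr₀ : 0 < r₀)
    (a₁ a₂ : ℝ → RVec n → ℝ) (ac₁ ac₂ : ℂ → CVec n → ℂ)
    (h₁ : HypH1 a₁ ∧ HypH2 R₀ r₀ a₁ ac₁ ∧ HypH3 R₀ r₀ ac₁)
    (h₂ : HypH1 a₂ ∧ HypH2 R₀ r₀ a₂ ac₂ ∧ HypH3 R₀ r₀ ac₂)
    (hDN : ∀ s : ℝ, ∃ ρ > 0, ∀ p ∈ isotropicCone n ρ, ∀ h : RVec n → ℂ, MemC2 α Ω h →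
      linDN α Ω ac₁ s p h = linDN α Ω ac₂ s p h) :
    ∀ s ∈ band R₀, ∀ p ∈ transversalCone Ω r₀, ac₁ s p = ac₂ s p := by

  intro s hs p hp
  have han₁ := h₁.2.1.analyticOnNhd
  have han₂ := h₂.2.1.analyticOnNhd
  have hreal : ∀ t : ℝ, ac₁ t p = ac₂ t p := by
    intro t
    -- The real value at `p = 0`, positive by the first hypothesis, is the ellipticity constant for
    -- uniqueness.
    have ht : ac₂ t 0 = (a₂ t 0 : ℂ) := by
      rw [← h₂.2.1.2 t 0 (by simpa using hr₀)]
      congr 1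
    obtain ⟨ρ, hρ, heq⟩ := exists_radius_add_cdot_gradP_eq (by omega) hΩ.isOpen hΩ.isBounded h0
      hR₀ hr₀ han₁ han₂ (h₂.1 t 0) ht (hDN t)
    exact eq_on_transversalCone_of_add_cdot_gradP_eq hR₀ hr₀ han₁ han₂ hρ heq hp
  have hband : ∀ {ac : ℂ → CVec n → ℂ} {a : ℝ → RVec n → ℝ}, HypH2 R₀ r₀ a ac →
      AnalyticOn ℂ (fun z => ac z p) (band R₀) := fun {ac a} h =>
    h.1.comp₂ analyticOn_id analyticOn_const
      fun z hz => mk_mem_prod hz (by simpa using hp.1)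
  exact eqOn_band_of_eq_ofReal hR₀ (hband h₁.2.1) (hband h₂.2.1) hreal hs
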